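/- Let $V$ be a real potential on $\mathbb Z$ (resp. on $\mathbb N=\{1,2,\dots\}$), and let $H$ be the self-adjoint operator on $\ell^2(\mathbb Z)$ (resp. $\ell^2(\mathbb N)$, with Dirichlet boundary condition $\psi(0)=0$) $$H\psi(n)=\psi(n-1)+\psi(n+1)+V(n)\psi(n).$$ Put $\psi(t,n)=(e^{-itH}\delta_1)(n)$, $$a(n,T)=\frac1T\int_0^\infty e^{-2t/T}|\psi(t,n)|^2\,dt,\qquad \langle|X|^p\rangle(T)=\sum_n|n|^p a(n,T).$$ For $z\in\mathbb C$ let $A(n,z)=\begin{pmatrix} z-V(n)&-1\\1&0\end{pmatrix}$, and define the transfer matrices by $T(n,m;z)=A(n,z)A(n-1,z)\cdots A(m+1,z)$ for $n>m$, $T(n,n;z)=I$, and $T(n,m;z)=T(m,n;z)^{-1}$ for $n<m$; $\|\cdot\|$ is the operator norm on $\mathbb C^2$ with the Euclidean norm. Let $K,C,\alpha>0$, and suppose that for every sufficiently large real $N$ there is a nonempty Borel set $A(N)\subset[-K,K]$ such that $$\|T(n,m;E)\|\le C N^\alpha\quad\text{for all }E\in A(N)\text{ and all integers } n,m\text{ with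 }|n|\le N,\ |m|\le N$$ (resp. with $1\le n\le N$, $1\le m\le N$ in the case of $\ell^2(\mathbb N)$). Let $N(T)=T^{1/(1+\alpha)}$ and $B(T)=\{E\in\mathbb R:\exists E'\in A(N(T)),\ |E-E'|\le 1/T\}$, and let $|B(T)|$ denote the Lebesgue measure of $B(T)$. Then there is a constant $\hat C>0$, depending only on $V,K,C,\alpha$, such that for all sufficiently large $T$ $$\sum_{|n|\ge N(T)/2}a(n,T)\ \ge\ \frac{\hat C}{T}\,|B(T)|\,N(T)^{1-2\alpha}.$$ Moreover, for every $p>0$ there is a constant $\hat C_p>0$, depending only on $V,K,C,\alpha,p$, such that for all sufficiently large $T$ $$\langle|X|^p\rangle(T)\ \ge\ \frac{\hat C_p}{T}\,|B(T)|\,N(T)^{p+1-2\alpha}.$$ -/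

import Mathlib

open Complex Set Filter Topology MeasureTheory
open scoped ENNReal

namespace DiscreteSchrodinger

/-! The unitary group generated by a self-adjoint operator is characterised in
`IsUnitaryGroupGeneratedBy`. The surrounding lemmas serve only to prove that such a group exists for
the discrete Schrödinger operator with an arbitrary, possibly unbounded, real potential. -/

section Abstract

theorem norm_const_of_inner_re_zero {E : Type*} [NormedAddCommGroup E] [InnerProductSpace ℂ E]
    {α v : ℝ → E} {s : Set ℝ} (hs : Convex ℝ s)
    (hα : ∀ t ∈ s, HasDerivWithinAt α (v t) s t)
    (hv : ∀ t ∈ s, (inner ℂ (α t) (v t)).re = 0) {a b : ℝ} (ha : a ∈ s) (hb : b ∈ s) :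
    ‖α a‖ = ‖α b‖ := by
  have key : ∀ t ∈ s, HasDerivWithinAt (fun t => inner ℂ (α t) (α t)) 0 s t := by
    intro t ht
    refine ((hα t ht).inner ℂ (hα t ht)).congr_deriv ?_
    rw [← inner_conj_symm (v t) (α t), Complex.add_conj, hv t ht]; simp
  have h := hs.norm_image_sub_le_of_norm_hasDerivWithin_le key (C := 0) (by simp) ha hb
  rw [zero_mul, norm_le_zero_iff, sub_eq_zero, inner_self_eq_norm_sq_to_K,
    inner_self_eq_norm_sq_to_K] at h
  have h' : ‖α b‖ ^ 2 = ‖α a‖ ^ 2 := by exact_mod_cast h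
  exact ((sq_eq_sq₀ (norm_nonneg _) (norm_nonneg _)).1 h').symm

variable {E : Type*} [NormedAddCommGroup E] [InnerProductSpace ℂ E]

theorem re_inner_neg_I_smul {A : E →L[ℂ] E} (hA : ∀ x y, inner ℂ (A x) y = inner ℂ x (A y))
    (x : E) : (inner ℂ x (-I • A x)).re = 0 := by
  have h : (starRingEnd ℂ) (inner ℂ x (A x)) = inner ℂ x (A x) := by
    rw [inner_conj_symm, hA]
  rw [inner_smul_right]
  have := Complex.conj_eq_iff_im.1 h
  simp [this]

theorem ode_unique {W : ℝ → E →L[ℂ] E}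
    (hsym : ∀ t x y, inner ℂ (W t x) y = inner ℂ x (W t y))
    {s : Set ℝ} (hs : Convex ℝ s) {α β : ℝ → E}
    (hα : ∀ t ∈ s, HasDerivWithinAt α (-I • W t (α t)) s t)
    (hβ : ∀ t ∈ s, HasDerivWithinAt β (-I • W t (β t)) s t)
    {a b : ℝ} (ha : a ∈ s) (hb : b ∈ s) (h : α a = β a) : α b = β b := by
  have h1 := norm_const_of_inner_re_zero hs (α := fun t => α t - β t)
    (v := fun t => -I • W t (α t - β t)) (fun t ht => by
      have := (hα t ht).fun_sub (hβ t ht)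
      rwa [← smul_sub, ← map_sub] at this)
    (fun t _ => re_inner_neg_I_smul (hsym t) _) hb ha
  rw [h, sub_self, norm_zero, norm_eq_zero] at h1
  exact sub_eq_zero.1 h1

/-- Radial retraction onto the closed ball of radius `R`, in the form used below. -/
theorem lipschitz_retraction (R : ℝ) (hR : 0 < R) (x y : E) :
    ‖((R / max R ‖x‖ : ℝ) : ℂ) • x - ((R / max R ‖y‖ : ℝ) : ℂ) • y‖ ≤ 2 * ‖x - y‖ := by
  set m := max R ‖x‖
  set m' := max R ‖y‖
  have hm : 0 < m := lt_max_of_lt_left hR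
  have hm' : 0 < m' := lt_max_of_lt_left hR
  have e : ((R / m : ℝ) : ℂ) • x - ((R / m' : ℝ) : ℂ) • y
      = ((R / m : ℝ) : ℂ) • (x - y) + ((R / m - R / m' : ℝ) : ℂ) • y := by
    rw [smul_sub]; push_cast; rw [sub_smul]; abel
  have h1 : R / m ≤ 1 := (div_le_one hm).2 (le_max_left _ _)
  have h2 : |R / m - R / m'| * ‖y‖ ≤ ‖x - y‖ := by
    have : R / m - R / m' = (R / m) * ((m' - m) / m') := by field_simp
    rw [this, abs_mul, abs_of_pos (div_pos hR hm), abs_div, abs_of_pos hm']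
    have h3 : |m' - m| ≤ ‖x - y‖ := by
      calc |m' - m| ≤ |‖y‖ - ‖x‖| := by
            simpa using abs_max_sub_max_le_max R ‖y‖ R ‖x‖
        _ ≤ ‖y - x‖ := abs_norm_sub_norm_le y x
        _ = ‖x - y‖ := norm_sub_rev _ _
    have h4 : ‖y‖ ≤ m' := le_max_right _ _
    calc R / m * (|m' - m| / m') * ‖y‖ = (R / m) * |m' - m| * (‖y‖ / m') := by ring
      _ ≤ 1 * ‖x - y‖ * 1 := by
        gcongr
        exact (div_le_one hm').2 h4
      _ = _ := by ring
  rw [e]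
  refine (norm_add_le _ _).trans ?_
  rw [norm_smul, norm_smul, Complex.norm_real, Complex.norm_real, Real.norm_eq_abs,
    Real.norm_eq_abs, abs_of_pos (div_pos hR hm)]
  nlinarith [norm_nonneg (x - y)]

theorem ode_exists_Icc [CompleteSpace E] {W : ℝ → E →L[ℂ] E}
    (hcont : ∀ x, Continuous fun t => W t x)
    (hsym : ∀ t x y, inner ℂ (W t x) y = inner ℂ x (W t y))
    (M : ℝ) (hM : ∀ t x, ‖W t x‖ ≤ M * ‖x‖) (x : E) (T : ℝ) (hT : 0 ≤ T) :
    ∃ α : ℝ → E, α 0 = x ∧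
      ∀ t ∈ Icc (-T) T, HasDerivWithinAt α (-I • W t (α t)) (Icc (-T) T) t := by
  set R : ℝ := ‖x‖ + 1
  have hR : 0 < R := by positivity
  set c : E → ℂ := fun y => ((R / max R ‖y‖ : ℝ) : ℂ)
  have hM' : ∀ t y, ‖W t y‖ ≤ |M| * ‖y‖ := fun t y =>
    (hM t y).trans (by gcongr; exact le_abs_self M)
  have hc : ∀ y : E, ‖c y • y‖ ≤ R := by
    intro y
    have hm : 0 < max R ‖y‖ := lt_max_of_lt_left hR
    simp only [c, norm_smul, Complex.norm_real, Real.norm_eq_abs]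
    rw [abs_of_pos (div_pos hR hm), div_mul_eq_mul_div, div_le_iff₀ hm]
    gcongr
    exact le_max_right _ _
  have h0 : (0 : ℝ) ∈ Icc (-T) T := ⟨by linarith, hT⟩
  have hPL : IsPicardLindelof (fun t y => -I • W t (c y • y)) (⟨0, h0⟩ : Icc (-T) T) x
      (Real.toNNReal (|M| * R * T)) 0 (Real.toNNReal (|M| * R)) (Real.toNNReal (|M| * 2)) := by
    refine ⟨fun t _ => LipschitzOnWith.of_dist_le_mul fun y _ z _ => ?_, fun y _ => ?_,
      fun t _ y _ => ?_, ?_⟩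
    · rw [dist_eq_norm, dist_eq_norm, ← smul_sub, ← map_sub, norm_smul, norm_neg, norm_I, one_mul,
        Real.coe_toNNReal _ (by positivity), mul_assoc]
      exact (hM' t _).trans (by gcongr; exact lipschitz_retraction R hR y z)
    · exact ((hcont _).const_smul _).continuousOn
    · rw [norm_smul, norm_neg, norm_I, one_mul, Real.coe_toNNReal _ (by positivity)]
      exact (hM' t _).trans (by gcongr; exact hc y)
    · rw [Real.coe_toNNReal _ (by positivity), Real.coe_toNNReal _ (by positivity)]
      simp
  obtain ⟨α, hα0, hα⟩ := hPL.exists_eq_forall_mem_Icc_hasDerivWithinAt₀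
  refine ⟨α, hα0, fun t ht => ?_⟩
  have hn : ‖α t‖ = ‖x‖ := by
    rw [← hα0]
    refine norm_const_of_inner_re_zero (convex_Icc _ _) hα (fun t _ => ?_) ht h0
    have : -I • W t (c (α t) • α t) = c (α t) • (-I • W t (α t)) := by
      rw [map_smul, smul_comm]
    rw [this, inner_smul_right, Complex.re_ofReal_mul, re_inner_neg_I_smul (hsym t), mul_zero]
  have hc1 : c (α t) = 1 := by
    simp only [c, hn]
    rw [max_eq_left (by simp [R]), div_self hR.ne', Complex.ofReal_one]
  have := hα t ht
  rwa [hc1, one_smul] at this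

theorem ode_exists [CompleteSpace E] {W : ℝ → E →L[ℂ] E}
    (hcont : ∀ x, Continuous fun t => W t x)
    (hsym : ∀ t x y, inner ℂ (W t x) y = inner ℂ x (W t y))
    (M : ℝ) (hM : ∀ t x, ‖W t x‖ ≤ M * ‖x‖) (x : E) :
    ∃ η : ℝ → E, η 0 = x ∧ ∀ t, HasDerivAt η (-I • W t (η t)) t := by
  have H : ∀ T : ℝ, ∃ α : ℝ → E, 0 ≤ T → α 0 = x ∧
      ∀ t ∈ Icc (-T) T, HasDerivWithinAt α (-I • W t (α t)) (Icc (-T) T) t := by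
    intro T
    by_cases hT : 0 ≤ T
    · obtain ⟨α, h⟩ := ode_exists_Icc hcont hsym M hM x T hT
      exact ⟨α, fun _ => h⟩
    · exact ⟨fun _ => x, fun h => absurd h hT⟩
  choose α hα using H
  have hglue : ∀ S T t : ℝ, |t| ≤ S → S ≤ T → α S t = α T t := by
    intro S T t hS hST
    have hS0 : 0 ≤ S := (abs_nonneg t).trans hS
    have hT0 : 0 ≤ T := hS0.trans hST
    have hsub : Icc (-S) S ⊆ Icc (-T) T := Icc_subset_Icc (by linarith) hST
    exact ode_unique hsym (convex_Icc (-S) S) (hα S hS0).2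
      (fun t ht => ((hα T hT0).2 t (hsub ht)).mono hsub)
      (a := 0) ⟨by linarith, hS0⟩ (abs_le.1 hS) ((hα S hS0).1.trans (hα T hT0).1.symm)
  refine ⟨fun t => α (|t| + 1) t, by simpa using (hα 1 zero_le_one).1, fun t => ?_⟩
  have hp : 0 ≤ |t| + 2 := by positivity
  have ht : t ∈ Ioo (-(|t| + 2)) (|t| + 2) := by
    constructor
    · linarith [neg_abs_le t]
    · linarith [le_abs_self t]
  have h1 : HasDerivAt (α (|t| + 2)) (-I • W t (α (|t| + 2) t)) t :=
    ((hα _ hp).2 t (Ioo_subset_Icc_self ht)).hasDerivAt (Icc_mem_nhds ht.1 ht.2)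
  rw [← hglue (|t| + 1) (|t| + 2) t (by linarith) (by linarith)] at h1
  refine h1.congr_of_eventuallyEq ?_
  have : ∀ᶠ s in 𝓝 t, |s| < |t| + 1 :=
    (continuous_abs.tendsto t).eventually (gt_mem_nhds (by linarith))
  filter_upwards [this] with s hs
  exact hglue _ _ s (by linarith) (by linarith)

/-- `U` is a strongly continuous one-parameter group of unitary operators with generator `-iH`
(`H` a possibly unbounded operator): `(U t x - x) / t` converges as `t → 0` exactly when `x` lies in
the domain of `H`, and then the limit is `-i H x`. That is, `U t = exp (-itH)`. -/
def IsUnitaryGroupGeneratedBy (H : E →ₗ.[ℂ] E) (U : ℝ → E ≃ₗᵢ[ℂ] E) : Prop :=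
  (∀ s t x, U (s + t) x = U s (U t x)) ∧
  (∀ x, Continuous fun t => U t x) ∧
  ∀ x y, (x, y) ∈ H.graph ↔
    Tendsto (fun t : ℝ => (t : ℂ)⁻¹ • (U t x - x)) (𝓝[≠] 0) (𝓝 (-I • y))

theorem continuous_apply_of_isometry {D : ℝ → E ≃ₗᵢ[ℂ] E} (hD : ∀ x, Continuous fun t => D t x)
    {a : ℝ → ℝ} {g : ℝ → E} (ha : Continuous a) (hg : Continuous g) :
    Continuous fun t => D (a t) (g t) :=
  (continuous_prod_of_continuous_lipschitzWith (fun p : E × ℝ => D p.2 p.1) 1 hD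
    (fun t => (D t).isometry.lipschitz)).comp (hg.prodMk ha)

theorem hasDerivAt_zero_iff (F : ℝ → E) (y : E) :
    HasDerivAt F y 0 ↔
      Tendsto (fun t : ℝ => (t : ℂ)⁻¹ • (F t - F 0)) (𝓝[≠] 0) (𝓝 y) := by
  rw [hasDerivAt_iff_tendsto_slope]
  refine tendsto_congr fun t => ?_
  rw [slope_def_module, sub_zero, ← Complex.ofReal_inv, Complex.coe_smul]

theorem exists_perturbed_group [CompleteSpace E] (D : ℝ → E ≃ₗᵢ[ℂ] E)
    (hgrp : ∀ s t x, D (s + t) x = D s (D t x)) (hcont : ∀ x, Continuous fun t => D t x)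
    (J : E →L[ℂ] E) (hJ : ∀ x y, inner ℂ (J x) y = inner ℂ x (J y)) :
    ∃ U : ℝ → E ≃ₗᵢ[ℂ] E, (∀ s t x, U (s + t) x = U s (U t x)) ∧
      (∀ x, Continuous fun t => U t x) ∧
      ∀ x y, Tendsto (fun t : ℝ => (t : ℂ)⁻¹ • (D t x - x)) (𝓝[≠] 0) (𝓝 y) ↔
        Tendsto (fun t : ℝ => (t : ℂ)⁻¹ • (U t x - x)) (𝓝[≠] 0) (𝓝 (y - I • J x)) := by
  have hD0 : ∀ x, D 0 x = x := fun x => by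
    have := hgrp 0 0 x
    rw [add_zero] at this
    exact ((D 0).injective this).symm
  have hDn : ∀ t x, D t (D (-t) x) = x := fun t x => by rw [← hgrp, add_neg_cancel, hD0]
  have hnD : ∀ t x, D (-t) (D t x) = x := fun t x => by rw [← hgrp, neg_add_cancel, hD0]
  set W : ℝ → E →L[ℂ] E := fun t =>
    ((D (-t)).toContinuousLinearEquiv : E →L[ℂ] E) ∘L J ∘L ((D t).toContinuousLinearEquiv : E →L[ℂ] E)
  have hW : ∀ t x, W t x = D (-t) (J (D t x)) := fun t x => rfl
  have hadj : ∀ t x y, inner ℂ (D (-t) x) y = inner ℂ x (D t y) := fun t x y => by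
    rw [← (D t).inner_map_map, hDn]
  have hadj' : ∀ t x y, inner ℂ (D t x) y = inner ℂ x (D (-t) y) := fun t x y => by
    rw [← (D (-t)).inner_map_map, hnD]
  have hsym : ∀ t x y, inner ℂ (W t x) y = inner ℂ x (W t y) := fun t x y => by
    rw [hW, hW, hadj, hJ, hadj']
  have hWc : ∀ g : ℝ → E, Continuous g → Continuous fun t => W t (g t) := fun g hg =>
    continuous_apply_of_isometry hcont continuous_neg
      (J.continuous.comp (continuous_apply_of_isometry hcont continuous_id hg))
  have hM : ∀ t x, ‖W t x‖ ≤ ‖J‖ * ‖x‖ := fun t x => by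
    rw [hW, LinearIsometryEquiv.norm_map]
    exact (J.le_opNorm _).trans (by rw [LinearIsometryEquiv.norm_map])
  choose η h0 hη using ode_exists (fun x => hWc _ continuous_const) hsym ‖J‖ hM
  have huniq : ∀ x (α : ℝ → E), α 0 = x → (∀ t, HasDerivAt α (-I • W t (α t)) t) → α = η x := by
    intro x α hα0 hα
    ext1 t
    exact ode_unique hsym convex_univ (fun t _ => (hα t).hasDerivWithinAt)
      (fun t _ => (hη x t).hasDerivWithinAt) (mem_univ 0) (mem_univ t) (hα0.trans (h0 x).symm)
  have hadd : ∀ x y t, η (x + y) t = η x t + η y t := fun x y t => by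
    refine (congrFun (huniq (x + y) (fun t => η x t + η y t) (by simp [h0]) fun t => ?_) t).symm
    rw [map_add, smul_add]
    exact (hη x t).add (hη y t)
  have hsmul : ∀ (c : ℂ) x t, η (c • x) t = c • η x t := fun c x t => by
    refine (congrFun (huniq (c • x) (fun t => c • η x t) (by simp [h0]) fun t => ?_) t).symm
    rw [map_smul, smul_comm]
    exact (hη x t).const_smul c
  have hnorm : ∀ x t, ‖η x t‖ = ‖x‖ := fun x t => by
    have := (norm_const_of_inner_re_zero convex_univ (fun t _ => (hη x t).hasDerivWithinAt)
      (fun t _ => re_inner_neg_I_smul (hsym t) _) (mem_univ t) (mem_univ 0))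
    rwa [h0] at this
  have hηc : ∀ x, Continuous (η x) := fun x =>
    continuous_iff_continuousAt.2 fun t => (hη x t).continuousAt
  have hstep : ∀ s t x, D (t + s) (η x (t + s)) = D t (η (D s (η x s)) t) := by
    intro s t x
    rw [hgrp]
    congr 1
    refine congrFun (huniq _ (fun t => D s (η x (t + s))) (by simp) fun t => ?_) t
    have h1 : HasDerivAt (fun t => η x (t + s)) (-I • W (t + s) (η x (t + s))) t :=
      (hη x (t + s)).comp_add_const t s
    have h2 := (((D s).toContinuousLinearEquiv : E →L[ℂ] E).restrictScalars ℝ).hasFDerivAt.comp_hasDerivAt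
      t h1
    refine h2.congr_deriv ?_
    change D s (-I • W (t + s) (η x (t + s))) = _
    rw [map_smul, hW, hW, ← hgrp, ← hgrp, show s + -(t + s) = -t by ring]
  let u : ℝ → E →ₗᵢ[ℂ] E := fun t =>
    { toFun := fun x => D t (η x t)
      map_add' := fun x y => by rw [hadd, map_add]
      map_smul' := fun c x => by rw [hsmul, map_smul]; rfl
      norm_map' := fun x => by
        change ‖D t (η x t)‖ = ‖x‖
        rw [LinearIsometryEquiv.norm_map, hnorm] }
  have hu : ∀ t x, u t x = D t (η x t) := fun _ _ => rfl
  have hug : ∀ s t x, u (s + t) x = u s (u t x) := fun s t x => hstep t s x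
  have hu0 : ∀ x, u 0 x = x := fun x => by rw [hu, h0, hD0]
  let U : ℝ → E ≃ₗᵢ[ℂ] E := fun t =>
    LinearIsometryEquiv.ofSurjective (u t) fun x => ⟨u (-t) x, by
      rw [← hug, add_neg_cancel, hu0]⟩
  refine ⟨U, hug, fun x => continuous_apply_of_isometry hcont continuous_id (hηc x), fun x y => ?_⟩
  have hd : HasDerivAt (fun t => D t (η x t - x)) (-I • J x) 0 := by
    rw [hasDerivAt_iff_tendsto_slope]
    have hs : Tendsto (fun t : ℝ => slope (η x) 0 t) (𝓝[≠] 0) (𝓝 (-I • J x)) := by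
      have := hasDerivAt_iff_tendsto_slope.1 (hη x 0)
      rwa [h0, hW, hD0, neg_zero, hD0] at this
    have hc : Continuous fun p : E × ℝ => D p.2 p.1 :=
      continuous_prod_of_continuous_lipschitzWith (fun p : E × ℝ => D p.2 p.1) 1 hcont
        (fun t => (D t).isometry.lipschitz)
    have := (hc.tendsto (-I • J x, 0)).comp
      (hs.prodMk_nhds (tendsto_id.mono_left nhdsWithin_le_nhds))
    simp only [hD0] at this
    refine this.congr fun t => ?_
    simp only [Function.comp, slope, vsub_eq_sub, h0, sub_self, map_zero, sub_zero, id]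
    exact ((D t).toLinearEquiv.toLinearMap.restrictScalars ℝ).map_smul _ _
  have hU : (fun t => U t x) = fun t => D t x + D t (η x t - x) := by
    ext1 t
    change D t (η x t) = _
    rw [← map_add, add_sub_cancel]
  have e1 := hasDerivAt_zero_iff (fun t => D t x) y
  have e2 := hasDerivAt_zero_iff (fun t => U t x) (y - I • J x)
  have hU0 : U 0 x = x := hu0 x
  simp only [hD0, hU0] at e1 e2
  rw [← e1, ← e2]
  constructor
  · intro h
    rw [hU, sub_eq_add_neg, ← neg_smul]
    exact h.add hd
  · intro h
    have := h.sub hd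
    rw [neg_smul, sub_neg_eq_add, sub_add_cancel] at this
    refine this.congr_of_eventuallyEq (Eventually.of_forall fun t => ?_)
    simp [hU]

end Abstract

section Diagonal

variable {ι : Type*}

theorem summable_norm_sq (f : lp (fun _ : ι => ℂ) 2) : Summable fun n => ‖f n‖ ^ 2 := by
  simpa using (lp.memℓp f).summable (by simp)

theorem hasSum_norm_sq (f : lp (fun _ : ι => ℂ) 2) : HasSum (fun n => ‖f n‖ ^ 2) (‖f‖ ^ 2) := by
  simpa using lp.hasSum_norm (p := 2) (by simp) f

theorem memℓp_two {u : ι → ℂ} (h : Summable fun n => ‖u n‖ ^ 2) : Memℓp u 2 :=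
  memℓp_gen (by simpa using h)

theorem norm_phase (s : ℝ) : ‖cexp (-I * s)‖ = 1 := by
  rw [show -I * (s : ℂ) = ((-s : ℝ) : ℂ) * I by push_cast; ring]
  exact Complex.norm_exp_ofReal_mul_I _

/-- The multiplication operator `f n ↦ exp (-i t V n) f n`. -/
noncomputable def phase (V : ι → ℝ) (t : ℝ) (f : lp (fun _ : ι => ℂ) 2) :
    lp (fun _ : ι => ℂ) 2 :=
  ⟨fun n => cexp (-I * ((t * V n : ℝ) : ℂ)) * f n, memℓp_two (by
    simp only [norm_mul, norm_phase, one_mul]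
    exact summable_norm_sq f)⟩

theorem phase_apply (V : ι → ℝ) (t : ℝ) (f : lp (fun _ : ι => ℂ) 2) (n : ι) :
    phase V t f n = cexp (-I * ((t * V n : ℝ) : ℂ)) * f n := rfl

theorem phase_add (V : ι → ℝ) (s t : ℝ) (f : lp (fun _ : ι => ℂ) 2) :
    phase V (s + t) f = phase V s (phase V t f) := by
  ext n
  rw [phase_apply, phase_apply, phase_apply, ← mul_assoc, ← Complex.exp_add]
  congr 2
  push_cast; ring

theorem phase_zero (V : ι → ℝ) (f : lp (fun _ : ι => ℂ) 2) : phase V 0 f = f := by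
  ext n
  simp [phase_apply]

/-- The unitary group of the multiplication operator by `V`. -/
noncomputable def phaseGroup (V : ι → ℝ) (t : ℝ) :
    lp (fun _ : ι => ℂ) 2 ≃ₗᵢ[ℂ] lp (fun _ : ι => ℂ) 2 where
  toFun := phase V t
  invFun := phase V (-t)
  left_inv f := by rw [← phase_add, neg_add_cancel, phase_zero]
  right_inv f := by rw [← phase_add, add_neg_cancel, phase_zero]
  map_add' f g := by
    ext n
    simp only [phase_apply, lp.coeFn_add, Pi.add_apply]
    ring
  map_smul' c f := by
    ext n
    simp only [phase_apply, lp.coeFn_smul, Pi.smul_apply, smul_eq_mul, RingHom.id_apply]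
    ring
  norm_map' f := by
    have h1 := hasSum_norm_sq f
    have h2 := hasSum_norm_sq (phase V t f)
    simp only [phase_apply, norm_mul, norm_phase, one_mul] at h2
    exact (sq_eq_sq₀ (norm_nonneg _) (norm_nonneg _)).1 (h2.unique h1)

theorem phaseGroup_apply (V : ι → ℝ) (t : ℝ) (f : lp (fun _ : ι => ℂ) 2) (n : ι) :
    phaseGroup V t f n = cexp (-I * ((t * V n : ℝ) : ℂ)) * f n :=
  phase_apply V t f n

theorem tendsto_of_tsum {l : Filter ℝ} {F : ℝ → lp (fun _ : ι => ℂ) 2}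
    {G : lp (fun _ : ι => ℂ) 2} {b : ι → ℝ} (hb : Summable b)
    (hlim : ∀ n, Tendsto (fun t => F t n) l (𝓝 (G n)))
    (hbound : ∀ᶠ t in l, ∀ n, ‖F t n - G n‖ ^ 2 ≤ b n) : Tendsto F l (𝓝 G) := by
  rw [tendsto_iff_norm_sub_tendsto_zero]
  have h : Tendsto (fun t => ∑' n, ‖F t n - G n‖ ^ 2) l (𝓝 (∑' _ : ι, (0 : ℝ))) := by
    refine tendsto_tsum_of_dominated_convergence hb (fun n => ?_) ?_
    · have := (tendsto_iff_norm_sub_tendsto_zero.1 (hlim n)).pow 2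
      simpa using this
    · filter_upwards [hbound] with t ht n
      simpa using ht n
  rw [tsum_zero] at h
  have h2 : ∀ t, ∑' n, ‖F t n - G n‖ ^ 2 = ‖F t - G‖ ^ 2 := fun t => by
    have := (hasSum_norm_sq (F t - G)).tsum_eq
    simpa using this
  simp only [h2] at h
  have := h.sqrt
  simpa using this

theorem continuous_phaseGroup (V : ι → ℝ) (f : lp (fun _ : ι => ℂ) 2) :
    Continuous fun t => phaseGroup V t f := by
  refine continuous_iff_continuousAt.2 fun t => ?_
  refine tendsto_of_tsum ((summable_norm_sq f).mul_left 4) (fun n => ?_)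
    (Eventually.of_forall fun s n => ?_)
  · simp only [phaseGroup_apply]
    have : Continuous fun t : ℝ => cexp (-I * ((t * V n : ℝ) : ℂ)) * f n := by fun_prop
    exact this.tendsto t
  · have h : ‖phaseGroup V s f n - phaseGroup V t f n‖ ≤ 2 * ‖f n‖ := by
      refine (norm_sub_le _ _).trans ?_
      rw [phaseGroup_apply, phaseGroup_apply, norm_mul, norm_mul, norm_phase, norm_phase]
      linarith
    calc _ ≤ (2 * ‖f n‖) ^ 2 := by gcongr
      _ = _ := by ring

theorem norm_exp_sub_one_le (s : ℝ) : ‖cexp (-I * s) - 1‖ ≤ |s| := by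
  have := Real.norm_exp_I_mul_ofReal_sub_one_le (x := -s)
  rw [show -I * (s : ℂ) = I * ((-s : ℝ) : ℂ) by push_cast; ring]
  simpa using this

theorem hasDerivAt_phase (V : ℝ) (z : ℂ) :
    HasDerivAt (fun t : ℝ => cexp (-I * ((t * V : ℝ) : ℂ)) * z) (-I * (V * z)) 0 := by
  have h1 : HasDerivAt (fun t : ℝ => -I * ((t * V : ℝ) : ℂ)) (-I * V) 0 := by
    have := ((hasDerivAt_id (0 : ℝ)).mul_const V).ofReal_comp.const_mul (-I)
    simpa using this
  have := h1.cexp.mul_const z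
  refine this.congr_deriv ?_
  simp; ring

theorem tendsto_phaseGroup_iff (V : ι → ℝ) (f g : lp (fun _ : ι => ℂ) 2) :
    Tendsto (fun t : ℝ => (t : ℂ)⁻¹ • (phaseGroup V t f - f)) (𝓝[≠] 0) (𝓝 (-I • g)) ↔
      ∀ n, g n = V n * f n := by
  have hc : ∀ (t : ℝ) n, ((t : ℂ)⁻¹ • (phaseGroup V t f - f)) n
      = (t : ℂ)⁻¹ • (cexp (-I * ((t * V n : ℝ) : ℂ)) * f n - f n) := fun t n => rfl
  have hG : ∀ n, (-I • g) n = -I * g n := fun n => rfl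
  have hl : ∀ n, Tendsto (fun t : ℝ => ((t : ℂ)⁻¹ • (phaseGroup V t f - f)) n) (𝓝[≠] 0)
      (𝓝 (-I * (V n * f n))) := fun n => by
    have := (hasDerivAt_zero_iff _ _).1 (hasDerivAt_phase (V n) (f n))
    simpa [hc] using this
  constructor
  · intro h n
    have h1 := ((lp.evalCLM ℂ (fun _ : ι => ℂ) 2 n).continuous.tendsto _).comp h
    have := tendsto_nhds_unique h1 (hl n)
    change -I * g n = _ at this
    exact mul_left_cancel₀ (neg_ne_zero.2 I_ne_zero) this
  · intro h
    refine tendsto_of_tsum ((summable_norm_sq g).mul_left 4) (fun n => ?_)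
      (Eventually.of_forall fun t n => ?_)
    · rw [hG, h]
      exact hl n
    · have h1 : ‖((t : ℂ)⁻¹ • (phaseGroup V t f - f)) n‖ ≤ ‖g n‖ := by
        rw [hc, h, ← sub_one_mul, norm_smul, norm_mul, norm_mul, norm_inv,
          Complex.norm_real, Real.norm_eq_abs, Complex.norm_real, Real.norm_eq_abs]
        rcases eq_or_ne t 0 with rfl | ht
        · simp; positivity
        · have h2 := norm_exp_sub_one_le (t * V n)
          rw [abs_mul] at h2
          rw [inv_mul_le_iff₀ (abs_pos.2 ht), ← mul_assoc]
          gcongr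
      have h2 : ‖(-I • g) n‖ = ‖g n‖ := by rw [hG]; simp
      calc _ ≤ (‖g n‖ + ‖g n‖) ^ 2 := by
            gcongr
            exact (norm_sub_le _ _).trans (by rw [h2]; gcongr)
        _ = _ := by ring

end Diagonal

section Operator

/-- The one-dimensional lattices under consideration. -/
inductive LatticeKind
  | wholeLine
  | halfLine

/-- The sites of the lattice, as a set of integers: all of `ℤ`, or `{1, 2, 3, …}`. -/
def LatticeKind.sites : LatticeKind → Set ℤ
  | .wholeLine => Set.univ
  | .halfLine => Set.Ici 1

theorem LatticeKind.one_mem_sites (Λ : LatticeKind) : (1 : ℤ) ∈ Λ.sites := by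
  cases Λ <;> simp [LatticeKind.sites]

/-- The Hilbert space `ℓ²(ℤ)` or `ℓ²(ℕ)`. -/
abbrev LatticeKind.Hilbert (Λ : LatticeKind) : Type := lp (fun _ : Λ.sites => ℂ) 2

variable {Λ : LatticeKind}

/-- Extension of a function on the sites to `ℤ` by zero. -/
noncomputable def extendZero (u : Λ.sites → ℂ) : ℤ → ℂ :=
  Function.extend Subtype.val u 0

/-- The formal difference expression `(H u)(n) = u (n-1) + u (n+1) + V n u n`.
On the half-line `u 0` is read as `0` (Dirichlet boundary condition). -/
noncomputable def formalOperator (V : ℤ → ℝ) (u : Λ.sites → ℂ) (n : Λ.sites) : ℂ :=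
  extendZero u (n - 1) + extendZero u (n + 1) + V n * u n

theorem extendZero_apply (u : Λ.sites → ℂ) (n : Λ.sites) : extendZero u n = u n :=
  Subtype.val_injective.extend_apply u 0 n

theorem extendZero_add (u v : Λ.sites → ℂ) : extendZero (u + v) = extendZero u + extendZero v := by
  have := Function.extend_add (Subtype.val : Λ.sites → ℤ) u v 0 0
  rwa [add_zero] at this

theorem extendZero_smul (c : ℂ) (u : Λ.sites → ℂ) : extendZero (c • u) = c • extendZero u := by
  have := Function.extend_smul c (Subtype.val : Λ.sites → ℤ) u 0
  rwa [smul_zero] at this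

theorem formalOperator_add (V : ℤ → ℝ) (u v : Λ.sites → ℂ) :
    formalOperator V (u + v) = formalOperator V u + formalOperator V v := by
  ext n
  simp only [formalOperator, extendZero_add, Pi.add_apply]
  ring

theorem formalOperator_smul (V : ℤ → ℝ) (c : ℂ) (u : Λ.sites → ℂ) :
    formalOperator V (c • u) = c • formalOperator V u := by
  ext n
  simp only [formalOperator, extendZero_smul, Pi.smul_apply, smul_eq_mul]
  ring

/-- The discrete Schrödinger operator with potential `V` in `ℓ²`, on its natural (maximal) domain
of all `u ∈ ℓ²` with `H u ∈ ℓ²`. The potential may be unbounded; for bounded `V` the domain is the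
whole space. -/
noncomputable def schrodinger (Λ : LatticeKind) (V : ℤ → ℝ) : Λ.Hilbert →ₗ.[ℂ] Λ.Hilbert where
  domain :=
    { carrier := {u | Memℓp (formalOperator V u) 2}
      add_mem' := fun {u v} hu hv => by
        change Memℓp (formalOperator V (u + v : Λ.Hilbert)) 2
        rw [lp.coeFn_add, formalOperator_add]
        exact hu.add hv
      zero_mem' := by
        change Memℓp (formalOperator V (0 : Λ.Hilbert)) 2
        have := formalOperator_smul V 0 ((0 : Λ.Hilbert) : Λ.sites → ℂ)
        rw [zero_smul, zero_smul] at this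
        rw [lp.coeFn_zero, this]
        exact zero_memℓp
      smul_mem' := fun c u hu => by
        change Memℓp (formalOperator V (c • u : Λ.Hilbert)) 2
        rw [lp.coeFn_smul, formalOperator_smul]
        exact hu.const_smul c }
  toFun :=
    { toFun := fun u => ⟨formalOperator V (u : Λ.Hilbert), u.2⟩
      map_add' := fun u v => by
        ext n
        exact congrFun (formalOperator_add V (u : Λ.Hilbert) (v : Λ.Hilbert)) n
      map_smul' := fun c u => by
        ext n
        exact congrFun (formalOperator_smul V c (u : Λ.Hilbert)) n }

theorem mem_graph_schrodinger (V : ℤ → ℝ) (x y : Λ.Hilbert) :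
    (x, y) ∈ (schrodinger Λ V).graph ↔ ∀ n, y n = formalOperator V x n := by
  rw [LinearPMap.mem_graph_iff]
  constructor
  · rintro ⟨z, rfl, rfl⟩ n
    rfl
  · intro h
    have hy : formalOperator V x = y := funext fun n => (h n).symm
    refine ⟨⟨x, ?_⟩, rfl, ?_⟩
    · change Memℓp (formalOperator V x) 2
      rw [hy]
      exact lp.memℓp y
    · ext n
      exact (h n).symm

theorem hasSum_extendZero (f : Λ.Hilbert) :
    HasSum (fun k => ‖extendZero f k‖ ^ 2) (‖f‖ ^ 2) := by
  refine ((Subtype.val_injective (p := (· ∈ Λ.sites))).hasSum_iff (fun k hk => ?_)).1 ?_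
  · rw [extendZero, Function.extend_apply' _ _ _ hk]; simp
  · simpa [Function.comp_def, extendZero_apply] using hasSum_norm_sq f

theorem summable_shift (c : ℤ) (f : Λ.Hilbert) :
    Summable fun n : Λ.sites => ‖extendZero f (n + c)‖ ^ 2 :=
  (hasSum_extendZero f).summable.comp_injective
    (i := fun n : Λ.sites => (n : ℤ) + c) fun _ _ h => Subtype.ext (add_right_cancel h)

/-- Translation by `c`. -/
noncomputable def shift (c : ℤ) : Λ.Hilbert →L[ℂ] Λ.Hilbert :=
  LinearMap.mkContinuous
    { toFun := fun f => ⟨fun n => extendZero f (n + c), memℓp_two (summable_shift c f)⟩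
      map_add' := fun f g => by
        ext n
        exact congrFun (extendZero_add (f : Λ.sites → ℂ) g) (n + c)
      map_smul' := fun a f => by
        ext n
        exact congrFun (extendZero_smul a (f : Λ.sites → ℂ)) (n + c) } 1 fun f => by
    rw [one_mul]
    refine (sq_le_sq₀ (norm_nonneg _) (norm_nonneg _)).1 ?_
    have h1 := hasSum_norm_sq (⟨fun n => extendZero f (n + c), memℓp_two (summable_shift c f)⟩ :
      Λ.Hilbert)
    have h2 := hasSum_extendZero f
    exact hasSum_le_inj (fun n : Λ.sites => (n : ℤ) + c)
      (fun _ _ h => Subtype.ext (add_right_cancel h)) (fun k _ => sq_nonneg _)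
      (fun n => le_refl (‖extendZero f (n + c)‖ ^ 2)) h1 h2

theorem shift_apply (c : ℤ) (f : Λ.Hilbert) (n : Λ.sites) : shift c f n = extendZero f (n + c) :=
  rfl

theorem inner_eq_tsum_extendZero (f : Λ.Hilbert) (u : ℤ → ℂ) :
    ∑' n : Λ.sites, inner ℂ (f n) (u n) = ∑' k : ℤ, inner ℂ (extendZero f k) (u k) := by
  rw [← (Subtype.val_injective (p := (· ∈ Λ.sites))).tsum_eq (f := fun k : ℤ => inner ℂ (extendZero f k) (u k))]
  · simp only [extendZero_apply]
  · intro k hk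
    by_contra h
    refine hk ?_
    simp only [extendZero, Function.extend_apply' _ _ _ h]
    simp

theorem inner_shift (c : ℤ) (f g : Λ.Hilbert) :
    inner ℂ (shift c f) g = inner ℂ f (shift (-c) g) := by
  have h1 : inner ℂ f (shift (-c) g)
      = ∑' k : ℤ, inner ℂ (extendZero f k) (extendZero g (k + -c)) := by
    rw [lp.inner_eq_tsum]
    exact inner_eq_tsum_extendZero f fun k => extendZero g (k + -c)
  have h2 : inner ℂ g (shift c f)
      = ∑' k : ℤ, inner ℂ (extendZero g k) (extendZero f (k + c)) := by
    rw [lp.inner_eq_tsum]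
    exact inner_eq_tsum_extendZero g fun k => extendZero f (k + c)
  rw [← inner_conj_symm, h2, h1, Complex.conj_tsum,
    ← (Equiv.addRight c).tsum_eq fun k => inner ℂ (extendZero f k) (extendZero g (k + -c))]
  simp only [inner_conj_symm, Equiv.coe_addRight, add_neg_cancel_right]

/-- Existence of the unitary group generated by `H`. -/
theorem exists_unitaryGroup (Λ : LatticeKind) (V : ℤ → ℝ) :
    ∃ U, IsUnitaryGroupGeneratedBy (schrodinger Λ V) U := by
  obtain ⟨U, h1, h2, h3⟩ := exists_perturbed_group (phaseGroup fun n : Λ.sites => V n)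
    (fun s t f => phase_add _ s t f) (continuous_phaseGroup _)
    (shift (-1) + shift 1 : Λ.Hilbert →L[ℂ] Λ.Hilbert) (fun f g => by
      simp only [add_apply, inner_add_left, inner_add_right, inner_shift,
        neg_neg]
      ring)
  refine ⟨U, h1, h2, fun x y => ?_⟩
  set J : Λ.Hilbert →L[ℂ] Λ.Hilbert := shift (-1) + shift 1
  have e : -I • y = -I • (y - J x) - I • J x := by
    rw [smul_sub, neg_smul, neg_smul]; abel
  rw [e, ← h3, tendsto_phaseGroup_iff, mem_graph_schrodinger]
  refine forall_congr' fun n => ?_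
  have : (y - J x) n = y n - (extendZero x (n - 1) + extendZero x (n + 1)) := rfl
  rw [this, sub_eq_iff_eq_add, formalOperator, add_comm]

/-- The unitary group `U t = exp (-itH)` generated by `H`. -/
noncomputable def unitaryGroup (Λ : LatticeKind) (V : ℤ → ℝ) : ℝ → Λ.Hilbert ≃ₗᵢ[ℂ] Λ.Hilbert :=
  (exists_unitaryGroup Λ V).choose

/-- The initial state `δ_1`. -/
noncomputable def deltaOne (Λ : LatticeKind) : Λ.Hilbert :=
  lp.single 2 ⟨1, Λ.one_mem_sites⟩ 1

/-- `ψ(t,n)`, the value at site `n` of `exp (-itH) δ_1`. -/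
noncomputable def amplitude (Λ : LatticeKind) (V : ℤ → ℝ) (t : ℝ) (n : Λ.sites) : ℂ :=
  unitaryGroup Λ V t (deltaOne Λ) n

/-- `a(n,T) = (1/T) ∫_0^∞ exp (-2t/T) |ψ(t,n)|² dt`. -/
noncomputable def timeAverage (Λ : LatticeKind) (V : ℤ → ℝ) (n : Λ.sites) (T : ℝ) : ℝ :=
  1 / T * ∫ t in Ioi (0 : ℝ), Real.exp (-2 * t / T) * ‖amplitude Λ V t n‖ ^ 2

/-- The time-averaged outside probability: the sum of `a(n,T)` over the sites with `|n| ≥ R`. -/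
noncomputable def outsideProbability (Λ : LatticeKind) (V : ℤ → ℝ) (R T : ℝ) : ℝ≥0∞ :=
  ∑' n : {n : Λ.sites // R ≤ |((n : ℤ) : ℝ)|}, ENNReal.ofReal (timeAverage Λ V n T)

/-- The time-averaged moment `∑ |n|^p a(n,T)` of the position operator. -/
noncomputable def moment (Λ : LatticeKind) (V : ℤ → ℝ) (p T : ℝ) : ℝ≥0∞ :=
  ∑' n : Λ.sites, ENNReal.ofReal (|((n : ℤ) : ℝ)| ^ p * timeAverage Λ V n T)

end Operator

section Transfer

/-- The one-step transfer matrix `A(n,z)`. -/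
noncomputable def stepMatrix (V : ℤ → ℝ) (n : ℤ) (z : ℂ) : Matrix (Fin 2) (Fin 2) ℂ :=
  !![z - V n, -1; 1, 0]

/-- The product `A(m+k,z) ⋯ A(m+1,z)`. -/
noncomputable def stepProduct (V : ℤ → ℝ) (m : ℤ) (z : ℂ) : ℕ → Matrix (Fin 2) (Fin 2) ℂ
  | 0 => 1
  | k + 1 => stepMatrix V (m + (k + 1 : ℕ)) z * stepProduct V m z k

/-- The transfer matrix `T(n,m;z)`: the product `A(n,z) ⋯ A(m+1,z)` for `n > m`, the identity for
`n = m`, and the inverse of `T(m,n;z)` for `n < m`. -/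
noncomputable def transferMatrix (V : ℤ → ℝ) (n m : ℤ) (z : ℂ) : Matrix (Fin 2) (Fin 2) ℂ :=
  if m ≤ n then stepProduct V m z (n - m).toNat else (stepProduct V n z (m - n).toNat)⁻¹

/-- The operator norm of a `2 × 2` matrix acting on `ℂ²` with its Euclidean norm. -/
noncomputable def opNorm (M : Matrix (Fin 2) (Fin 2) ℂ) : ℝ :=
  ‖Matrix.toEuclideanCLM (𝕜 := ℂ) M‖

/-- For all large `N`, `A N` is a nonempty Borel subset of `[-K,K]`, and
`‖T(n,m;E)‖ ≤ C N^α` for all `E ∈ A N` and all sites `n`, `m` with `|n| ≤ N`, `|m| ≤ N`. -/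
def PowerLawBound (Λ : LatticeKind) (V : ℤ → ℝ) (K C α : ℝ) (A : ℝ → Set ℝ) : Prop :=
  ∀ᶠ N : ℝ in atTop, (A N).Nonempty ∧ MeasurableSet (A N) ∧ A N ⊆ Icc (-K) K ∧
    ∀ E ∈ A N, ∀ n ∈ Λ.sites, ∀ m ∈ Λ.sites, |(n : ℝ)| ≤ N → |(m : ℝ)| ≤ N →
      opNorm (transferMatrix V n m (E : ℂ)) ≤ C * N ^ α

/-- `N(T) = T^(1/(1+α))`. -/
noncomputable def scale (α T : ℝ) : ℝ := T ^ (1 / (1 + α))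

/-- `B(T)`, the `1/T`-neighbourhood of `A(N(T))`. -/
def energyNeighbourhood (α : ℝ) (A : ℝ → Set ℝ) (T : ℝ) : Set ℝ :=
  {E | ∃ E' ∈ A (scale α T), |E - E'| ≤ 1 / T}

end Transfer

end DiscreteSchrodinger

open DiscreteSchrodinger

namespace DiscreteSchrodinger

/-!
For `z = E + i/T` the vector `u = ∫₀^∞ e^{izt} e^{-itH} δ_1 dt` solves `(H - z) u = -i δ_1`. The
source forces the values of `u` next to the site `1` not all to be small. For `E' ∈ A(N(T))` with
`|E - E'| ≤ 1/T`, the bound `C N^α` on the transfer matrices at `E'` survives, up to a constant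
factor, when `E'` is replaced by `z` on at most `N` consecutive sites, because
`C N^α · |z - E'| · N ≤ 2 C` when `N^(1+α) = T`. Hence `|u(n)|² + |u(n+1)|² ≥ c N^(-2α)` on one side
of the origin, and the sum of `|u(n)|²` over `N/2 ≤ |n| ≤ N` is at least `c N^(1-2α)`. By
Plancherel in `E`, the integral of `|u(n)|²` over all energies is `2πT a(n,T)`, so integrating this
lower bound over `B(T)` gives the theorem.
-/

section Plancherel

open FourierTransform SchwartzMap

variable {W F : Type*} [NormedAddCommGroup W] [InnerProductSpace ℝ W] [FiniteDimensional ℝ W]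
  [MeasurableSpace W] [BorelSpace W]

theorem continuous_fourier_of_integrable [NormedAddCommGroup F] [NormedSpace ℂ F] {f : W → F}
    (hf : Integrable f) : Continuous (𝓕 f) :=
  VectorFourier.fourierIntegral_continuous Real.continuous_fourierChar continuous_inner hf

theorem integral_cexp_smul_eq_fourier [NormedAddCommGroup F] [NormedSpace ℂ F]
    (f : ℝ → F) (E : ℝ) :
    ∫ t : ℝ, cexp (I * E * t) • f t = 𝓕 f (-(2 * Real.pi)⁻¹ * E) := by
  rw [Real.fourier_eq']
  congr with t
  congr 2
  simp only [RCLike.inner_apply, conj_trivial]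
  push_cast
  field_simp

variable [NormedAddCommGroup F] [InnerProductSpace ℂ F] [CompleteSpace F]

theorem coeFn_fourier_toLp {f : W → F} (h1 : Integrable f) (h2 : MemLp f 2) :
    ((𝓕 (h2.toLp f) : Lp F 2 (volume : Measure W)) : W → F) =ᵐ[volume] 𝓕 f := by
  refine ae_eq_of_integral_contDiff_smul_eq ((Lp.memLp _).locallyIntegrable one_le_two)
    (continuous_fourier_of_integrable h1).locallyIntegrable fun g hg hg_supp => ?_
  have hφ_supp : HasCompactSupport (Complex.ofRealCLM ∘ g) := hg_supp.comp_left rfl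
  have hφ_smooth : ContDiff ℝ (⊤ : ℕ∞) (Complex.ofRealCLM ∘ g) := by fun_prop
  let φ : 𝓢(W, ℂ) := hφ_supp.toSchwartzMap hφ_smooth
  have smul_eq (x : W) (v : F) : g x • v = φ x • v := (Complex.coe_smul (g x) v).symm
  have pairing_L2 : ∫ x, φ x • (𝓕 (h2.toLp f) : Lp F 2 (volume : Measure W)) x
      = ∫ x, 𝓕 φ x • h2.toLp f x := by
    have h := congrArg (fun d => d φ) (Lp.fourier_toTemperedDistribution_eq (h2.toLp f))
    simpa only [TemperedDistribution.fourier_apply, Lp.toTemperedDistribution_apply] using h.symm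
  have pairing_L1 : ∫ x, 𝓕 φ x • f x = ∫ x, φ x • 𝓕 f x := by
    have h := VectorFourier.integral_fourierIntegral_smul_eq_flip (L := innerₗ W) (μ := volume)
      (ν := volume) Real.continuous_fourierChar continuous_inner φ.integrable h1
    rwa [flip_innerₗ] at h
  simp only [smul_eq]
  rw [pairing_L2, ← pairing_L1]
  exact integral_congr_ae (h2.coeFn_toLp.mono fun x hx => congrArg (𝓕 φ x • ·) hx)

theorem eLpNorm_fourier_eq {f : W → F} (h1 : Integrable f) (h2 : MemLp f 2) :
    eLpNorm (𝓕 f) 2 volume = eLpNorm f 2 volume := by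
  rw [← eLpNorm_congr_ae (coeFn_fourier_toLp h1 h2), ← eLpNorm_congr_ae h2.coeFn_toLp,
    ← Lp.enorm_def, ← Lp.enorm_def, ← ofReal_norm, ← ofReal_norm, Lp.norm_fourier_eq]

theorem lintegral_enorm_sq_fourier {f : W → F} (h1 : Integrable f) (h2 : MemLp f 2) :
    ∫⁻ ξ, ‖𝓕 f ξ‖ₑ ^ 2 = ∫⁻ t, ‖f t‖ₑ ^ 2 := by
  have sq_eLpNorm (g : W → F) : eLpNorm g 2 volume ^ 2 = ∫⁻ t, ‖g t‖ₑ ^ 2 := by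
    simpa using eLpNorm_nnreal_pow_eq_lintegral (f := g) (p := 2) two_ne_zero
  rw [← sq_eLpNorm, ← sq_eLpNorm, eLpNorm_fourier_eq h1 h2]

theorem lintegral_comp_mul_left {a : ℝ} (ha : a ≠ 0) (g : ℝ → ℝ≥0∞) :
    ∫⁻ x, g (a * x) = ENNReal.ofReal |a⁻¹| * ∫⁻ x, g x := by
  have h := lintegral_map_equiv g (Homeomorph.mulLeft₀ a ha).toMeasurableEquiv (μ := volume)
  change ∫⁻ y, g y ∂(Measure.map (a * ·) volume) = ∫⁻ x, g (a * x) at h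
  rw [← h, Real.map_volume_mul_left ha, lintegral_smul_measure, smul_eq_mul]

theorem lintegral_enorm_sq_integral_cexp_smul {f : ℝ → F} (h1 : Integrable f) (h2 : MemLp f 2) :
    ∫⁻ E : ℝ, ‖∫ t : ℝ, cexp (I * E * t) • f t‖ₑ ^ 2
      = ENNReal.ofReal (2 * Real.pi) * ∫⁻ t, ‖f t‖ₑ ^ 2 := by
  simp only [integral_cexp_smul_eq_fourier]
  rw [lintegral_comp_mul_left (by simp [Real.pi_ne_zero]) fun ξ => ‖𝓕 f ξ‖ₑ ^ 2,
    lintegral_enorm_sq_fourier h1 h2, inv_neg, inv_inv, abs_neg, abs_of_pos Real.two_pi_pos]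

end Plancherel

section HalfLineTransform

variable {F : Type*} [NormedAddCommGroup F] {f : ℝ → F} {M : ℝ}

theorem norm_cexp_I_mul (z : ℂ) (t : ℝ) : ‖cexp (I * z * t)‖ = Real.exp (-z.im * t) := by
  simp [Complex.norm_exp]

theorem integrableOn_Ioi_cexp_smul [NormedSpace ℂ F] (hf : AEStronglyMeasurable f)
    (hM : ∀ t, ‖f t‖ ≤ M) {z : ℂ} (hz : 0 < z.im) (a : ℝ) :
    IntegrableOn (fun t : ℝ => cexp (I * z * t) • f t) (Ioi a) := by
  refine ((integrableOn_exp_mul_Ioi (neg_neg_of_pos hz) a).mul_const M).mono'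
    (((by fun_prop : Continuous fun t : ℝ => cexp (I * z * t)).aestronglyMeasurable.smul
      hf).restrict) (Eventually.of_forall fun t => ?_)
  rw [norm_smul, norm_cexp_I_mul]
  exact mul_le_mul_of_nonneg_left (hM t) (Real.exp_pos _).le

theorem integral_Ioi_cexp_smul_eq [NormedSpace ℂ F] (f : ℝ → F) (ε E : ℝ) :
    ∫ t in Ioi (0 : ℝ), cexp (I * (E + ε * I) * t) • f t
      = ∫ t : ℝ, cexp (I * E * t) •
          (Ioi (0 : ℝ)).indicator (fun t : ℝ => cexp (I * (ε * I) * t) • f t) t := by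
  rw [← integral_indicator measurableSet_Ioi]
  congr with t
  by_cases ht : t ∈ Ioi (0 : ℝ)
  · rw [indicator_of_mem ht, indicator_of_mem ht, smul_smul, ← Complex.exp_add]
    ring_nf
  · rw [indicator_of_notMem ht, indicator_of_notMem ht, smul_zero]

theorem continuous_integral_Ioi_cexp_smul [NormedSpace ℂ F] (hf : AEStronglyMeasurable f)
    (hM : ∀ t, ‖f t‖ ≤ M) {ε : ℝ} (hε : 0 < ε) :
    Continuous fun E : ℝ => ∫ t in Ioi (0 : ℝ), cexp (I * (E + ε * I) * t) • f t := by
  simp only [integral_Ioi_cexp_smul_eq, integral_cexp_smul_eq_fourier]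
  have hint := (integrableOn_Ioi_cexp_smul hf hM (z := ε * I) (by simpa using hε) 0)
  exact (continuous_fourier_of_integrable (hint.integrable_indicator measurableSet_Ioi)).comp
    (continuous_const_mul _)

theorem integrableOn_exp_mul_norm_sq (hf : AEStronglyMeasurable f) (hM : ∀ t, ‖f t‖ ≤ M)
    {ε : ℝ} (hε : 0 < ε) :
    IntegrableOn (fun t => Real.exp (-2 * ε * t) * ‖f t‖ ^ 2) (Ioi 0) := by
  refine ((integrableOn_exp_mul_Ioi (by linarith : -2 * ε < 0) 0).mul_const (M ^ 2)).mono'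
    (((by fun_prop : Continuous fun t => Real.exp (-2 * ε * t)).aestronglyMeasurable.mul
      (hf.norm.pow 2)).restrict) (Eventually.of_forall fun t => ?_)
  rw [Real.norm_of_nonneg (by positivity)]
  gcongr
  exact hM t

theorem lintegral_enorm_sq_integral_Ioi_cexp_smul [InnerProductSpace ℂ F] [CompleteSpace F]
    (hf : AEStronglyMeasurable f) (hM : ∀ t, ‖f t‖ ≤ M) {ε : ℝ} (hε : 0 < ε) :
    ∫⁻ E : ℝ, ‖∫ t in Ioi (0 : ℝ), cexp (I * (E + ε * I) * t) • f t‖ₑ ^ 2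
      = ENNReal.ofReal (2 * Real.pi * ∫ t in Ioi (0 : ℝ), Real.exp (-2 * ε * t) * ‖f t‖ ^ 2) := by
  have norm_sq (t : ℝ) : ‖cexp (I * (ε * I) * t) • f t‖ ^ 2
      = Real.exp (-2 * ε * t) * ‖f t‖ ^ 2 := by
    have him : (ε * I : ℂ).im = ε := by simp
    rw [norm_smul, norm_cexp_I_mul, him, mul_pow, ← Real.exp_nat_mul]
    ring_nf
  have hint := integrableOn_Ioi_cexp_smul hf hM (z := ε * I) (by simpa using hε) 0
  have hsq := integrableOn_exp_mul_norm_sq hf hM hε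
  have hL2 : MemLp (fun t : ℝ => cexp (I * (ε * I) * t) • f t) 2 (volume.restrict (Ioi 0)) := by
    rw [memLp_two_iff_integrable_sq_norm hint.aestronglyMeasurable]
    simpa only [norm_sq, IntegrableOn] using hsq
  simp only [integral_Ioi_cexp_smul_eq]
  rw [lintegral_enorm_sq_integral_cexp_smul (hint.integrable_indicator measurableSet_Ioi)
      ((memLp_indicator_iff_restrict measurableSet_Ioi).2 hL2),
    ENNReal.ofReal_mul Real.two_pi_pos.le,
    ofReal_integral_eq_lintegral_ofReal hsq (Eventually.of_forall fun t => by positivity),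
    ← lintegral_indicator measurableSet_Ioi]
  congr with t
  rw [enorm_indicator_eq_indicator_enorm]
  by_cases ht : t ∈ Ioi (0 : ℝ)
  · rw [indicator_of_mem ht, indicator_of_mem ht, ← norm_sq, ENNReal.ofReal_pow (norm_nonneg _),
      ofReal_norm]
  · simp [indicator_of_notMem ht]

end HalfLineTransform

section Resolvent

variable {E : Type*} [NormedAddCommGroup E] [InnerProductSpace ℂ E] {H : E →ₗ.[ℂ] E}
  {U : ℝ → E ≃ₗᵢ[ℂ] E}

theorem IsUnitaryGroupGeneratedBy.zero_apply (hU : IsUnitaryGroupGeneratedBy H U) (x : E) :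
    U 0 x = x :=
  (U 0).injective (by rw [← hU.1, add_zero])

theorem IsUnitaryGroupGeneratedBy.continuous (hU : IsUnitaryGroupGeneratedBy H U) (x : E) :
    Continuous fun t => U t x :=
  hU.2.1 x

/-- The vector `i (z - H)⁻¹ x`, as the Laplace transform of the group `U t = exp (-itH)`; it is
meaningful for `0 < im z` only. -/
noncomputable def resolventIntegral (U : ℝ → E ≃ₗᵢ[ℂ] E) (z : ℂ) (x : E) : E :=
  ∫ t in Ioi (0 : ℝ), cexp (I * z * t) • U t x

theorem IsUnitaryGroupGeneratedBy.integrableOn_resolventIntegral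
    (hU : IsUnitaryGroupGeneratedBy H U) {z : ℂ} (hz : 0 < z.im) (x : E) (a : ℝ) :
    IntegrableOn (fun t : ℝ => cexp (I * z * t) • U t x) (Ioi a) :=
  integrableOn_Ioi_cexp_smul (hU.continuous x).aestronglyMeasurable
    (fun t => ((U t).norm_map x).le) hz a

theorem IsUnitaryGroupGeneratedBy.apply_resolventIntegral (hU : IsUnitaryGroupGeneratedBy H U)
    {z : ℂ} (hz : 0 < z.im) (x : E) (h : ℝ) :
    U h (resolventIntegral U z x) = cexp (-(I * z) * h) •
      (resolventIntegral U z x - ∫ t in (0 : ℝ)..h, cexp (I * z * t) • U t x) := by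
  have hint := hU.integrableOn_resolventIntegral hz x
  have shift (t : ℝ) : U h (cexp (I * z * t) • U t x)
      = cexp (-(I * z) * h) • cexp (I * z * (t + h : ℝ)) • U (t + h) x := by
    rw [map_smul, ← hU.1, smul_smul, ← Complex.exp_add, add_comm t h]
    push_cast
    ring_nf
  have preimage_Ioi : (· + h) ⁻¹' Ioi h = Ioi (0 : ℝ) := by simp
  calc U h (resolventIntegral U z x)
      = ∫ t in Ioi (0 : ℝ), U h (cexp (I * z * t) • U t x) :=
        ((U h).toContinuousLinearEquiv.integral_comp_comm _).symm
    _ = cexp (-(I * z) * h) •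
          ∫ t in Ioi (0 : ℝ), cexp (I * z * (t + h : ℝ)) • U (t + h) x := by
        simp only [shift, integral_smul]
    _ = cexp (-(I * z) * h) • ∫ t in Ioi h, cexp (I * z * t) • U t x := by
        rw [← preimage_Ioi, (measurePreserving_add_right volume h).setIntegral_preimage_emb
          (measurableEmbedding_addRight h) fun t : ℝ => cexp (I * z * t) • U t x]
    _ = _ := by
        rw [resolventIntegral, ← intervalIntegral.integral_Ioi_sub_Ioi' (hint 0) (hint h),
          sub_sub_cancel]

theorem IsUnitaryGroupGeneratedBy.mem_graph_resolventIntegral [CompleteSpace E]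
    (hU : IsUnitaryGroupGeneratedBy H U) {z : ℂ} (hz : 0 < z.im) (x : E) :
    (resolventIntegral U z x, z • resolventIntegral U z x - I • x) ∈ H.graph := by
  set u := resolventIntegral U z x
  have hcont : Continuous fun t : ℝ => cexp (I * z * t) • U t x :=
    (by fun_prop : Continuous fun t : ℝ => cexp (I * z * t)).smul (hU.continuous x)
  have deriv_integral :
      HasDerivAt (fun h : ℝ => u - ∫ t in (0 : ℝ)..h, cexp (I * z * t) • U t x) (-x) 0 := by
    simpa [hU.zero_apply] using
      (hcont.integral_hasStrictDerivAt (0 : ℝ) 0).hasDerivAt.const_sub u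
  have deriv_exp : HasDerivAt (fun h : ℝ => cexp (-(I * z) * h)) (-(I * z)) 0 := by
    simpa using ((hasDerivAt_id (0 : ℝ)).ofReal_comp.const_mul (-(I * z))).cexp
  have deriv_orbit : HasDerivAt (fun h => U h u) (-I • (z • u - I • x)) 0 := by
    simp only [u, hU.apply_resolventIntegral hz]
    refine (deriv_exp.smul deriv_integral).congr_deriv ?_
    simp only [ofReal_zero, mul_zero, exp_zero, one_smul, intervalIntegral.integral_same, sub_zero,
      smul_neg, neg_smul, smul_sub, smul_smul, neg_mul, I_mul_I, neg_neg]
    abel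
  have h := (hasDerivAt_zero_iff _ _).1 deriv_orbit
  rw [hU.2.2]
  simpa only [hU.zero_apply] using h

theorem IsUnitaryGroupGeneratedBy.map_resolventIntegral [CompleteSpace E]
    {F : Type*} [NormedAddCommGroup F] [NormedSpace ℂ F] [CompleteSpace F]
    (hU : IsUnitaryGroupGeneratedBy H U) {z : ℂ} (hz : 0 < z.im) (L : E →L[ℂ] F) (x : E) :
    L (resolventIntegral U z x) = ∫ t in Ioi (0 : ℝ), cexp (I * z * t) • L (U t x) := by
  rw [resolventIntegral, ← L.integral_comp_comm (hU.integrableOn_resolventIntegral hz x 0)]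
  simp only [map_smul]

end Resolvent

section GreenFunction

variable {Λ : LatticeKind} {V : ℤ → ℝ}

theorem isUnitaryGroupGeneratedBy_unitaryGroup (Λ : LatticeKind) (V : ℤ → ℝ) :
    IsUnitaryGroupGeneratedBy (schrodinger Λ V) (unitaryGroup Λ V) :=
  (exists_unitaryGroup Λ V).choose_spec

theorem deltaOne_apply (n : Λ.sites) : deltaOne Λ n = if (n : ℤ) = 1 then 1 else 0 := by
  rw [deltaOne, lp.single_apply, Pi.single_apply]
  simp only [Subtype.ext_iff]

theorem norm_deltaOne (Λ : LatticeKind) : ‖deltaOne Λ‖ = 1 := by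
  rw [deltaOne, lp.norm_single two_pos, norm_one]

theorem extendZero_of_notMem {u : Λ.sites → ℂ} {k : ℤ} (hk : k ∉ Λ.sites) : extendZero u k = 0 :=
  Function.extend_apply' _ _ _ (by simpa using hk)

theorem continuous_amplitude (n : Λ.sites) : Continuous fun t => amplitude Λ V t n :=
  (lp.evalCLM ℂ (fun _ : Λ.sites => ℂ) 2 n).continuous.comp
    ((isUnitaryGroupGeneratedBy_unitaryGroup Λ V).continuous (deltaOne Λ))

theorem norm_amplitude_le_one (t : ℝ) (n : Λ.sites) : ‖amplitude Λ V t n‖ ≤ 1 := by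
  refine (lp.norm_apply_le_norm two_ne_zero _ n).trans ?_
  rw [LinearIsometryEquiv.norm_map, norm_deltaOne]

/-- The Green function with source at site `1`, normalised as `i (z - H)⁻¹ δ_1`. -/
noncomputable def greenFunction (Λ : LatticeKind) (V : ℤ → ℝ) (z : ℂ) : Λ.Hilbert :=
  resolventIntegral (unitaryGroup Λ V) z (deltaOne Λ)

theorem greenFunction_apply {z : ℂ} (hz : 0 < z.im) (n : Λ.sites) :
    greenFunction Λ V z n = ∫ t in Ioi (0 : ℝ), cexp (I * z * t) • amplitude Λ V t n :=
  (isUnitaryGroupGeneratedBy_unitaryGroup Λ V).map_resolventIntegral hz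
    (lp.evalCLM ℂ (fun _ : Λ.sites => ℂ) 2 n) (deltaOne Λ)

/-- `u` solves `(H - z) u = -i δ_1` as a difference equation on the sites of `Λ`, with Dirichlet
values off the sites. Unlike `greenFunction`, `u` is defined on all of `ℤ` and need not be square
summable. -/
structure IsGreenSolution (Λ : LatticeKind) (V : ℤ → ℝ) (z : ℂ) (u : ℤ → ℂ) : Prop where
  eq_zero_of_notMem : ∀ k ∉ Λ.sites, u k = 0
  eq_of_mem : ∀ k ∈ Λ.sites,
    u (k - 1) + u (k + 1) + V k * u k = z * u k - I * if k = 1 then 1 else 0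

theorem isGreenSolution_greenFunction {z : ℂ} (hz : 0 < z.im) :
    IsGreenSolution Λ V z (extendZero (greenFunction Λ V z)) where
  eq_zero_of_notMem _ hk := extendZero_of_notMem hk
  eq_of_mem k hk := by
    lift k to Λ.sites using hk
    have h := (mem_graph_schrodinger V _ _).1
      ((isUnitaryGroupGeneratedBy_unitaryGroup Λ V).mem_graph_resolventIntegral hz (deltaOne Λ)) k
    rw [extendZero_apply, ← deltaOne_apply]
    exact h.symm

theorem IsGreenSolution.eq_of_ne_one {z : ℂ} {u : ℤ → ℂ} (hu : IsGreenSolution Λ V z u) {k : ℤ}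
    (hk : k ∈ Λ.sites) (hk1 : k ≠ 1) : u (k - 1) + u (k + 1) + V k * u k = z * u k := by
  rw [hu.eq_of_mem k hk, if_neg hk1, mul_zero, sub_zero]

theorem IsGreenSolution.eq_one {z : ℂ} {u : ℤ → ℂ} (hu : IsGreenSolution Λ V z u) :
    u 0 + u 2 + V 1 * u 1 = z * u 1 - I := by
  simpa using hu.eq_of_mem 1 Λ.one_mem_sites

end GreenFunction

section TimeAverage

variable {Λ : LatticeKind} {V : ℤ → ℝ} {T : ℝ}

theorem continuous_greenFunction_apply (hT : 0 < T) (n : Λ.sites) :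
    Continuous fun E : ℝ => greenFunction Λ V (E + (1 / T : ℝ) * I) n := by
  have him (E : ℝ) : 0 < ((E : ℂ) + (1 / T : ℝ) * I).im := by simpa using hT
  simp only [greenFunction_apply (him _)]
  exact continuous_integral_Ioi_cexp_smul (continuous_amplitude n).aestronglyMeasurable
    (norm_amplitude_le_one · n) (one_div_pos.2 hT)

theorem lintegral_enorm_sq_greenFunction (hT : 0 < T) (n : Λ.sites) :
    ∫⁻ E : ℝ, ‖greenFunction Λ V (E + (1 / T : ℝ) * I) n‖ₑ ^ 2
      = ENNReal.ofReal (2 * Real.pi * T) * ENNReal.ofReal (timeAverage Λ V n T) := by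
  have him (E : ℝ) : 0 < ((E : ℂ) + (1 / T : ℝ) * I).im := by simpa using hT
  have integral_eq : ∫ t in Ioi (0 : ℝ), Real.exp (-2 * (1 / T) * t) * ‖amplitude Λ V t n‖ ^ 2
      = T * timeAverage Λ V n T := by
    rw [timeAverage, ← mul_assoc, mul_one_div_cancel hT.ne', one_mul]
    congr with t
    ring_nf
  simp only [greenFunction_apply (him _)]
  rw [lintegral_enorm_sq_integral_Ioi_cexp_smul (continuous_amplitude n).aestronglyMeasurable
      (norm_amplitude_le_one · n) (one_div_pos.2 hT), integral_eq,
    ← ENNReal.ofReal_mul (by positivity), mul_assoc (2 * Real.pi)]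

theorem ofReal_mul_volume_le_sum_timeAverage (hT : 0 < T) (F : Finset Λ.sites) {B : Set ℝ} {c : ℝ}
    (hB : ∀ E ∈ B, c ≤ ∑ n ∈ F, ‖greenFunction Λ V ((E : ℂ) + (1 / T : ℝ) * I) n‖ ^ 2) :
    ENNReal.ofReal c * volume B
      ≤ ENNReal.ofReal (2 * Real.pi * T) * ∑ n ∈ F, ENNReal.ofReal (timeAverage Λ V n T) := by
  have hmeas (n : Λ.sites) :
      Measurable fun E : ℝ => ‖greenFunction Λ V (E + (1 / T : ℝ) * I) n‖ₑ ^ 2 :=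
    (continuous_greenFunction_apply hT n).measurable.enorm.pow_const 2
  calc ENNReal.ofReal c * volume B
      = ∫⁻ _ in B, ENNReal.ofReal c := (setLIntegral_const B _).symm
    _ ≤ ∫⁻ E in B, ∑ n ∈ F, ‖greenFunction Λ V (E + (1 / T : ℝ) * I) n‖ₑ ^ 2 := by
        refine setLIntegral_mono (Finset.measurable_fun_sum F fun n _ => hmeas n) fun E hE => ?_
        simpa only [ENNReal.ofReal_sum_of_nonneg fun _ _ => sq_nonneg _,
          ENNReal.ofReal_pow (norm_nonneg _), ofReal_norm] using
          ENNReal.ofReal_le_ofReal (hB E hE)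
    _ ≤ ∫⁻ E : ℝ, ∑ n ∈ F, ‖greenFunction Λ V (E + (1 / T : ℝ) * I) n‖ₑ ^ 2 :=
        setLIntegral_le_lintegral _ _
    _ = _ := by
        simp only [lintegral_finsetSum F fun n _ => hmeas n, lintegral_enorm_sq_greenFunction hT,
          Finset.mul_sum]

end TimeAverage

section TransferMatrix

variable {V : ℤ → ℝ} {u : ℤ → ℂ} {z w : ℂ} {D δ : ℝ}

theorem det_stepMatrix (V : ℤ → ℝ) (n : ℤ) (z : ℂ) : (stepMatrix V n z).det = 1 := by
  simp [stepMatrix, Matrix.det_fin_two]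

theorem stepProduct_succ' (V : ℤ → ℝ) (m : ℤ) (z : ℂ) (k : ℕ) :
    stepProduct V m z (k + 1) = stepProduct V (m + 1) z k * stepMatrix V (m + 1) z := by
  induction k with
  | zero => simp [stepProduct]
  | succ k ih =>
    rw [stepProduct, ih, stepProduct, ← mul_assoc]
    congr 3
    push_cast
    ring

theorem transferMatrix_self (V : ℤ → ℝ) (n : ℤ) (z : ℂ) : transferMatrix V n n z = 1 := by
  simp [transferMatrix, stepProduct]

theorem transferMatrix_of_le {n m : ℤ} (h : n ≤ m) (V : ℤ → ℝ) (z : ℂ) :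
    transferMatrix V n m z = (stepProduct V n z (m - n).toNat)⁻¹ := by
  rcases h.eq_or_lt with rfl | h
  · simp [transferMatrix, stepProduct]
  · rw [transferMatrix, if_neg h.not_ge]

theorem transferMatrix_mul_stepMatrix (V : ℤ → ℝ) (n k : ℤ) (z : ℂ) :
    transferMatrix V n k z * stepMatrix V k z = transferMatrix V n (k - 1) z := by
  rcases le_or_gt k n with h | h
  · rw [transferMatrix, transferMatrix, if_pos h, if_pos (by linarith),
      show (n - (k - 1)).toNat = (n - k).toNat + 1 by omega, stepProduct_succ', sub_add_cancel]
  · rw [transferMatrix_of_le h.le, transferMatrix_of_le (Int.le_sub_one_of_lt h),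
      show (k - n).toNat = (k - 1 - n).toNat + 1 by omega, stepProduct, Matrix.mul_inv_rev,
      show n + (((k - 1 - n).toNat + 1 : ℕ) : ℤ) = k by omega, mul_assoc,
      Matrix.nonsing_inv_mul _ (by simp [det_stepMatrix]), mul_one]

/-- The Cauchy data `(u (k+1), u k)` of `u` at `k`, which the transfer matrices propagate. -/
noncomputable def cauchyData (u : ℤ → ℂ) (k : ℤ) : EuclideanSpace ℂ (Fin 2) :=
  WithLp.toLp 2 ![u (k + 1), u k]

theorem norm_sq_cauchyData (u : ℤ → ℂ) (k : ℤ) :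
    ‖cauchyData u k‖ ^ 2 = ‖u (k + 1)‖ ^ 2 + ‖u k‖ ^ 2 := by
  simp [EuclideanSpace.norm_sq_eq, cauchyData]

theorem norm_le_norm_cauchyData (u : ℤ → ℂ) (k : ℤ) : ‖u k‖ ≤ ‖cauchyData u k‖ :=
  PiLp.norm_apply_le (cauchyData u k) 1

theorem norm_add_one_le_norm_cauchyData (u : ℤ → ℂ) (k : ℤ) : ‖u (k + 1)‖ ≤ ‖cauchyData u k‖ :=
  PiLp.norm_apply_le (cauchyData u k) 0

theorem norm_toEuclideanCLM_le {M : Matrix (Fin 2) (Fin 2) ℂ} (hM : opNorm M ≤ D)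
    (x : EuclideanSpace ℂ (Fin 2)) : ‖Matrix.toEuclideanCLM (𝕜 := ℂ) M x‖ ≤ D * ‖x‖ :=
  ContinuousLinearMap.le_of_opNorm_le _ hM x

theorem cauchyData_sub_stepMatrix_apply (w : ℂ) {k : ℤ}
    (hu : u (k - 1) + u (k + 1) + V k * u k = z * u k) :
    cauchyData u k - Matrix.toEuclideanCLM (𝕜 := ℂ) (stepMatrix V k w) (cauchyData u (k - 1))
      = EuclideanSpace.single 0 ((z - w) * u k) := by
  ext i
  fin_cases i
  · suffices u (k + 1) - ((w - V k) * u k + -u (k - 1)) = (z - w) * u k by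
      simpa [cauchyData, stepMatrix, mul_comm] using this
    linear_combination hu
  · simp [cauchyData, stepMatrix]

theorem dist_transferMatrix_cauchyData_le {n k : ℤ}
    (hu : u (k - 1) + u (k + 1) + V k * u k = z * u k)
    (hT : opNorm (transferMatrix V n k w) ≤ D) (hz : ‖z - w‖ ≤ δ) :
    dist (Matrix.toEuclideanCLM (𝕜 := ℂ) (transferMatrix V n k w) (cauchyData u k))
      (Matrix.toEuclideanCLM (𝕜 := ℂ) (transferMatrix V n (k - 1) w) (cauchyData u (k - 1)))
      ≤ D * δ * ‖u k‖ := by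
  have hD : 0 ≤ D := (norm_nonneg _).trans hT
  rw [dist_eq_norm, ← transferMatrix_mul_stepMatrix, map_mul, mul_apply_eq_comp, ← map_sub,
    cauchyData_sub_stepMatrix_apply w hu, mul_assoc]
  refine (norm_toEuclideanCLM_le hT _).trans ?_
  rw [PiLp.norm_single, norm_mul]
  gcongr

end TransferMatrix

section Propagation

variable {V : ℤ → ℝ} {u : ℤ → ℂ} {z w : ℂ} {a b : ℤ} {D δ : ℝ}

theorem le_mul_exp_of_le_add_sum {a c : ℝ} {b : ℕ → ℝ} {J : ℕ} (ha : 0 ≤ a) (hc : 0 ≤ c)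
    (h : ∀ j ≤ J, b j ≤ a + ∑ i ∈ Finset.range j, c * b i) : b J ≤ a * Real.exp (c * J) := by
  have add_sum_le : ∀ j ≤ J, a + ∑ i ∈ Finset.range j, c * b i ≤ a * (1 + c) ^ j := by
    intro j
    induction j with
    | zero => simp
    | succ j ih =>
      intro hj
      calc a + ∑ i ∈ Finset.range (j + 1), c * b i
          = (a + ∑ i ∈ Finset.range j, c * b i) + c * b j := by
            rw [Finset.sum_range_succ, add_assoc]
        _ ≤ a * (1 + c) ^ j + c * (a * (1 + c) ^ j) := by
            have hbj := (h j (by omega)).trans (ih (by omega))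
            gcongr
            exact ih (by omega)
        _ = a * (1 + c) ^ (j + 1) := by ring
  refine (h J le_rfl).trans ((add_sum_le J le_rfl).trans ?_)
  rw [mul_comm c, Real.exp_nat_mul]
  gcongr
  linarith [Real.add_one_le_exp c]

theorem dist_transferMatrix_cauchyData_le_of_adjacent
    (hu : ∀ k ∈ Ioc a b, u (k - 1) + u (k + 1) + V k * u k = z * u k)
    (hT : ∀ n ∈ Icc a b, ∀ k ∈ Icc a b, opNorm (transferMatrix V n k w) ≤ D)
    (hz : ‖z - w‖ ≤ δ) {n k l : ℤ} (hn : n ∈ Icc a b) (hk : k ∈ Icc a b) (hl : l ∈ Icc a b)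
    (hkl : l = k + 1 ∨ k = l + 1) :
    dist (Matrix.toEuclideanCLM (𝕜 := ℂ) (transferMatrix V n k w) (cauchyData u k))
      (Matrix.toEuclideanCLM (𝕜 := ℂ) (transferMatrix V n l w) (cauchyData u l))
      ≤ D * δ * ‖cauchyData u k‖ := by
  have hDδ : 0 ≤ D * δ :=
    mul_nonneg ((norm_nonneg _).trans (hT n hn k hk)) ((norm_nonneg _).trans hz)
  simp only [mem_Icc] at hk hl
  rcases hkl with rfl | rfl
  · have h := dist_transferMatrix_cauchyData_le (hu (k + 1) ⟨by omega, hl.2⟩)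
      (hT n hn (k + 1) hl) hz
    rw [add_sub_cancel_right, dist_comm] at h
    exact h.trans (by gcongr; exact norm_add_one_le_norm_cauchyData u k)
  · have h := dist_transferMatrix_cauchyData_le (hu (l + 1) ⟨by omega, hk.2⟩)
      (hT n hn (l + 1) hk) hz
    rw [add_sub_cancel_right] at h
    exact h.trans (by gcongr; exact norm_le_norm_cauchyData u (l + 1))

-- Summing the one-step errors costs `D δ` per site; a product of one-step bounds would cost a
-- factor `D` per site.
theorem norm_cauchyData_le_of_path
    (hu : ∀ k ∈ Ioc a b, u (k - 1) + u (k + 1) + V k * u k = z * u k)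
    (hT : ∀ n ∈ Icc a b, ∀ k ∈ Icc a b, opNorm (transferMatrix V n k w) ≤ D)
    (hz : ‖z - w‖ ≤ δ) {s : ℕ → ℤ} {J : ℕ} (hs : ∀ i ≤ J, s i ∈ Icc a b)
    (hadj : ∀ i, s (i + 1) = s i + 1 ∨ s i = s (i + 1) + 1) :
    ‖cauchyData u (s J)‖ ≤ D * ‖cauchyData u (s 0)‖ * Real.exp (D * δ * J) := by
  have hs0 := hs 0 J.zero_le
  have hD : 0 ≤ D := (norm_nonneg _).trans (hT _ hs0 _ hs0)
  have hδ : 0 ≤ δ := (norm_nonneg _).trans hz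
  refine le_mul_exp_of_le_add_sum (b := fun j => ‖cauchyData u (s j)‖) (by positivity)
    (by positivity) fun j hj => ?_
  let transported (i : ℕ) : EuclideanSpace ℂ (Fin 2) :=
    Matrix.toEuclideanCLM (𝕜 := ℂ) (transferMatrix V (s j) (s i) w) (cauchyData u (s i))
  have transported_self : transported j = cauchyData u (s j) := by
    simp [transported, transferMatrix_self]
  have norm_transported_zero : ‖transported 0‖ ≤ D * ‖cauchyData u (s 0)‖ :=
    norm_toEuclideanCLM_le (hT _ (hs j hj) _ hs0) _
  have dist_transported := dist_le_range_sum_of_dist_le (f := transported) j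
    (d := fun i => D * δ * ‖cauchyData u (s i)‖) fun {i} hi =>
      dist_transferMatrix_cauchyData_le_of_adjacent hu hT hz (hs j hj) (hs i (by omega))
        (hs (i + 1) (by omega)) (hadj i)
  rw [dist_comm, dist_eq_norm] at dist_transported
  calc ‖cauchyData u (s j)‖ = ‖transported j‖ := by rw [transported_self]
    _ ≤ ‖transported 0‖ + ‖transported j - transported 0‖ := norm_le_norm_add_norm_sub' _ _
    _ ≤ _ := add_le_add norm_transported_zero dist_transported

theorem norm_cauchyData_le
    (hu : ∀ k ∈ Ioc a b, u (k - 1) + u (k + 1) + V k * u k = z * u k)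
    (hT : ∀ n ∈ Icc a b, ∀ k ∈ Icc a b, opNorm (transferMatrix V n k w) ≤ D)
    (hz : ‖z - w‖ ≤ δ) {k l : ℤ} (hk : k ∈ Icc a b) (hl : l ∈ Icc a b) :
    ‖cauchyData u l‖ ≤ D * ‖cauchyData u k‖ * Real.exp (D * δ * (b - a)) := by
  have hD : 0 ≤ D := (norm_nonneg _).trans (hT k hk k hk)
  have hδ : 0 ≤ δ := (norm_nonneg _).trans hz
  simp only [mem_Icc] at hk hl
  obtain ⟨s, J, hs, hadj, hs0, hsJ, hJ⟩ : ∃ (s : ℕ → ℤ) (J : ℕ), (∀ i ≤ J, s i ∈ Icc a b) ∧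
      (∀ i, s (i + 1) = s i + 1 ∨ s i = s (i + 1) + 1) ∧ s 0 = k ∧ s J = l ∧ (J : ℤ) ≤ b - a := by
    simp only [mem_Icc]
    rcases le_total k l with h | h
    · refine ⟨fun i => k + i, (l - k).toNat, fun i hi => ?_, fun i => ?_, ?_, ?_, ?_⟩ <;>
        beta_reduce <;> omega
    · refine ⟨fun i => k - i, (k - l).toNat, fun i hi => ?_, fun i => ?_, ?_, ?_, ?_⟩ <;>
        beta_reduce <;> omega
  have hJ' : (J : ℝ) ≤ b - a := by exact_mod_cast hJ
  have h := norm_cauchyData_le_of_path hu hT hz hs hadj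
  rw [hs0, hsJ] at h
  exact h.trans (by gcongr)

end Propagation

section OuterSites

variable {Λ : LatticeKind} {N η : ℝ} {f : ℤ → ℝ} {a b : ℤ}

open Classical in
/-- The finite set of sites with `N / 2 ≤ |n| ≤ N`, which carry the lower bound. -/
noncomputable def outerSites (Λ : LatticeKind) (N : ℝ) : Finset Λ.sites :=
  ((Finset.Icc (-⌊N⌋) ⌊N⌋).filter fun k : ℤ => N / 2 ≤ |(k : ℝ)|).subtype (· ∈ Λ.sites)

open Classical in
theorem mem_outerSites {n : Λ.sites} :
    n ∈ outerSites Λ N ↔ N / 2 ≤ |((n : ℤ) : ℝ)| ∧ |((n : ℤ) : ℝ)| ≤ N := by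
  rw [outerSites, Finset.mem_subtype, Finset.mem_filter, Finset.mem_Icc, and_comm, abs_le,
    neg_le, neg_le (a := N), Int.le_floor, Int.le_floor, Int.cast_neg]

theorem mul_le_two_mul_sum_Icc (hf : ∀ k, 0 ≤ f k) (hab : a ≤ b)
    (h : ∀ k ∈ Ico a b, η ≤ f (k + 1) + f k) :
    ((b : ℝ) - a) * η ≤ 2 * ∑ k ∈ Finset.Icc a b, f k := by
  have card_Ico : ((Finset.Ico a b).card : ℝ) = b - a := by
    exact_mod_cast (Int.card_Ico_of_le a b hab)
  calc ((b : ℝ) - a) * η = ∑ _k ∈ Finset.Ico a b, η := by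
        rw [Finset.sum_const, nsmul_eq_mul, card_Ico]
    _ ≤ ∑ k ∈ Finset.Ico a b, f (k + 1) + ∑ k ∈ Finset.Ico a b, f k := by
        rw [← Finset.sum_add_distrib]
        exact Finset.sum_le_sum fun k hk => h k (Finset.mem_Ico.1 hk)
    _ ≤ ∑ k ∈ Finset.Icc a b, f k + ∑ k ∈ Finset.Icc a b, f k := by
        refine add_le_add ?_
          (Finset.sum_le_sum_of_subset_of_nonneg Finset.Ico_subset_Icc_self fun k _ _ => hf k)
        rw [Finset.sum_Ico_add' f a b 1]
        refine Finset.sum_le_sum_of_subset_of_nonneg (fun k hk => ?_) fun k _ _ => hf k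
        rw [Finset.mem_Ico] at hk
        exact Finset.mem_Icc.2 ⟨by omega, by omega⟩
    _ = _ := (two_mul _).symm

theorem sum_Icc_le_sum_outerSites (hf : ∀ k, 0 ≤ f k)
    (h : ∀ k ∈ Icc a b, k ∈ Λ.sites ∧ N / 2 ≤ |(k : ℝ)| ∧ |(k : ℝ)| ≤ N) :
    ∑ k ∈ Finset.Icc a b, f k ≤ ∑ n ∈ outerSites Λ N, f n := by
  classical
  rw [← Finset.sum_subtype_of_mem f (p := (· ∈ Λ.sites)) fun k hk => (h k (Finset.mem_Icc.1 hk)).1]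
  refine Finset.sum_le_sum_of_subset_of_nonneg (fun n hn => ?_) fun n _ _ => hf n
  rw [Finset.mem_subtype, Finset.mem_Icc] at hn
  exact mem_outerSites.2 (h n hn).2

theorem quarter_le_floor_sub_ceil_half (hN : 8 ≤ N) : N / 4 ≤ (⌊N⌋ : ℝ) - ⌈N / 2⌉ := by
  linarith [Int.ceil_lt_add_one (N / 2), Int.lt_floor_add_one N]

theorem mul_le_sum_outerSites (hN : 0 ≤ N) (hη : 0 ≤ η) (hf : ∀ k, 0 ≤ f k)
    (hab : N / 4 ≤ (b : ℝ) - a)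
    (hout : ∀ k ∈ Icc a b, k ∈ Λ.sites ∧ N / 2 ≤ |(k : ℝ)| ∧ |(k : ℝ)| ≤ N)
    (h : ∀ k ∈ Ico a b, η ≤ f (k + 1) + f k) : N / 8 * η ≤ ∑ n ∈ outerSites Λ N, f n := by
  have hab' : a ≤ b := by
    have : (a : ℝ) ≤ b := by linarith
    exact_mod_cast this
  have := mul_le_two_mul_sum_Icc hf hab' h
  have := sum_Icc_le_sum_outerSites hf hout
  have : N / 4 * η ≤ ((b : ℝ) - a) * η := by gcongr
  linarith

theorem abs_le_of_mem_Icc_neg_floor {k : ℤ} (hk : k ∈ Icc (-⌊N⌋) ⌊N⌋) : |(k : ℝ)| ≤ N := by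
  rw [← Int.cast_abs]
  exact Int.le_floor.1 (abs_le.2 hk)

theorem half_le_abs_of_ceil_le_abs {k : ℤ} (hk : ⌈N / 2⌉ ≤ |k|) : N / 2 ≤ |(k : ℝ)| := by
  rw [← Int.cast_abs]
  exact Int.ceil_le.1 hk

theorem mul_le_sum_outerSites_of_right (hN : 8 ≤ N) (hη : 0 ≤ η) (hf : ∀ k, 0 ≤ f k)
    (hΛ : ∀ k ∈ Icc 1 ⌊N⌋, k ∈ Λ.sites) (h : ∀ k ∈ Icc 1 ⌊N⌋, η ≤ f (k + 1) + f k) :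
    N / 8 * η ≤ ∑ n ∈ outerSites Λ N, f n := by
  have hpos : 0 < ⌈N / 2⌉ := Int.ceil_pos.2 (by linarith)
  refine mul_le_sum_outerSites (a := ⌈N / 2⌉) (b := ⌊N⌋) (by linarith) hη hf
    (quarter_le_floor_sub_ceil_half hN) (fun k ⟨hak, hkb⟩ => ⟨hΛ k ⟨by omega, hkb⟩, ?_, ?_⟩)
    fun k ⟨hak, hkb⟩ => h k ⟨by omega, hkb.le⟩
  · exact half_le_abs_of_ceil_le_abs (hak.trans (le_abs_self k))
  · exact abs_le_of_mem_Icc_neg_floor ⟨by omega, hkb⟩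

theorem mul_le_sum_outerSites_of_left (hN : 8 ≤ N) (hη : 0 ≤ η) (hf : ∀ k, 0 ≤ f k)
    (hΛ : ∀ k ∈ Icc (-⌊N⌋) 0, k ∈ Λ.sites) (h : ∀ k ∈ Icc (-⌊N⌋) 0, η ≤ f (k + 1) + f k) :
    N / 8 * η ≤ ∑ n ∈ outerSites Λ N, f n := by
  have hpos : 0 < ⌈N / 2⌉ := Int.ceil_pos.2 (by linarith)
  refine mul_le_sum_outerSites (a := -⌊N⌋) (b := -⌈N / 2⌉) (by linarith) hη hf ?_
    (fun k ⟨hak, hkb⟩ => ⟨hΛ k ⟨hak, by omega⟩, ?_, ?_⟩) fun k ⟨hak, hkb⟩ => h k ⟨hak, by omega⟩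
  · push_cast
    linarith [quarter_le_floor_sub_ceil_half hN]
  · exact half_le_abs_of_ceil_le_abs (le_trans (by omega) (neg_le_abs k))
  · exact abs_le_of_mem_Icc_neg_floor ⟨hak, by omega⟩

end OuterSites

section LowerBound

variable {Λ : LatticeKind} {V : ℤ → ℝ} {u : ℤ → ℂ} {z w : ℂ} {C N α κ L : ℝ} {a b : ℤ}

/-- The transfer matrices at energy `w` between sites in `[-N, N]` have norm at most `D`. -/
def TransferBoundedBy (Λ : LatticeKind) (V : ℤ → ℝ) (N D : ℝ) (w : ℂ) : Prop :=
  ∀ n ∈ Λ.sites, ∀ m ∈ Λ.sites, |(n : ℝ)| ≤ N → |(m : ℝ)| ≤ N → opNorm (transferMatrix V n m w) ≤ D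

theorem IsGreenSolution.one_le_norm_add_mul_norm_cauchyData (hu : IsGreenSolution Λ V z u)
    (hL : |V 1| + ‖z‖ ≤ L) : 1 ≤ ‖u 0‖ + (1 + L) * ‖cauchyData u 1‖ := by
  have I_eq : I = (z - V 1) * u 1 - u 2 - u 0 := by linear_combination hu.eq_one
  have norm_sub_le_L : ‖z - V 1‖ ≤ L := by
    refine (norm_sub_le _ _).trans ?_
    rwa [norm_real, Real.norm_eq_abs, add_comm]
  have norm_u_two : ‖u 2‖ ≤ ‖cauchyData u 1‖ := norm_add_one_le_norm_cauchyData u 1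
  have norm_u_one : ‖u 1‖ ≤ ‖cauchyData u 1‖ := norm_le_norm_cauchyData u 1
  calc (1 : ℝ) = ‖(z - V 1) * u 1 - u 2 - u 0‖ := by rw [← I_eq, norm_I]
    _ ≤ ‖z - V 1‖ * ‖u 1‖ + ‖u 2‖ + ‖u 0‖ := by
        rw [← norm_mul]
        exact (norm_sub_le _ _).trans (by gcongr; exact norm_sub_le _ _)
    _ ≤ L * ‖cauchyData u 1‖ + ‖cauchyData u 1‖ + ‖u 0‖ := by
        gcongr
        exact (norm_nonneg _).trans norm_sub_le_L
    _ = _ := by ring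

theorem IsGreenSolution.inv_le_norm_cauchyData_or (hu : IsGreenSolution Λ V z u)
    (hL : |V 1| + ‖z‖ ≤ L) :
    (2 * (1 + L))⁻¹ ≤ ‖cauchyData u 1‖ ∨ Λ = .wholeLine ∧ (2 * (1 + L))⁻¹ ≤ ‖cauchyData u 0‖ := by
  have hL0 : 0 ≤ L := by linarith [abs_nonneg (V 1), norm_nonneg z]
  have inv_le_half : (2 * (1 + L))⁻¹ ≤ 1 / 2 := by
    rw [← one_div]
    gcongr
    linarith
  refine or_iff_not_imp_left.2 fun h => ?_
  have mul_lt_half : (1 + L) * ‖cauchyData u 1‖ < 1 / 2 := by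
    calc (1 + L) * ‖cauchyData u 1‖ < (1 + L) * (2 * (1 + L))⁻¹ := by gcongr; exact not_le.1 h
      _ = 1 / 2 := by field_simp
  have half_lt : 1 / 2 < ‖u 0‖ := by linarith [hu.one_le_norm_add_mul_norm_cauchyData hL]
  refine ⟨?_, by linarith [norm_le_norm_cauchyData u 0]⟩
  cases Λ with
  | wholeLine => rfl
  | halfLine =>
    rw [hu.eq_zero_of_notMem 0 (by simp [LatticeKind.sites]), norm_zero] at half_lt
    linarith

theorem div_mul_rpow_le_norm_cauchyData (hN : 0 < N) (hC : 0 < C)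
    (hu : ∀ k ∈ Ioc a b, u (k - 1) + u (k + 1) + V k * u k = z * u k)
    (hsites : Icc a b ⊆ Λ.sites ∩ Icc (-⌊N⌋) ⌊N⌋) (hab : (b : ℝ) - a ≤ N)
    (hw : TransferBoundedBy Λ V N (C * N ^ α) w) (hz : ‖z - w‖ ≤ 2 * N ^ (-(1 + α)))
    {k l : ℤ} (hk : k ∈ Icc a b) (hl : l ∈ Icc a b) (hκ : κ ≤ ‖cauchyData u k‖) :
    κ / (C * Real.exp (2 * C)) * N ^ (-α) ≤ ‖cauchyData u l‖ := by
  have hT : ∀ n ∈ Icc a b, ∀ m ∈ Icc a b, opNorm (transferMatrix V n m w) ≤ C * N ^ α :=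
    fun n hn m hm => hw n (hsites hn).1 m (hsites hm).1
      (abs_le_of_mem_Icc_neg_floor (hsites hn).2) (abs_le_of_mem_Icc_neg_floor (hsites hm).2)
  have exponent_le : C * N ^ α * (2 * N ^ (-(1 + α))) * (b - a) ≤ 2 * C := by
    calc C * N ^ α * (2 * N ^ (-(1 + α))) * (b - a)
        ≤ C * N ^ α * (2 * N ^ (-(1 + α))) * N := by gcongr
      _ = 2 * C * (N ^ α * N ^ (-(1 + α)) * N ^ (1 : ℝ)) := by rw [Real.rpow_one]; ring
      _ = 2 * C := by
        rw [← Real.rpow_add hN, ← Real.rpow_add hN, show α + -(1 + α) + 1 = 0 by ring,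
          Real.rpow_zero, mul_one]
  rw [div_mul_eq_mul_div, div_le_iff₀ (by positivity), Real.rpow_neg hN.le, ← div_eq_mul_inv,
    div_le_iff₀ (by positivity)]
  calc κ ≤ C * N ^ α * ‖cauchyData u l‖ * Real.exp (C * N ^ α * (2 * N ^ (-(1 + α))) * (b - a)) :=
        hκ.trans (norm_cauchyData_le hu hT hz hl hk)
    _ ≤ C * N ^ α * ‖cauchyData u l‖ * Real.exp (2 * C) := by gcongr
    _ = ‖cauchyData u l‖ * (C * Real.exp (2 * C)) * N ^ α := by ring

/-- The lower bound for the Cauchy data of a Green solution, in units of `N^(-α)`: the size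
`(2 (1 + L))⁻¹` forced by the source is transported at the cost of a factor `C e^(2C) N^α`. -/
noncomputable def lowerConstant (L C : ℝ) : ℝ := (2 * (1 + L))⁻¹ / (C * Real.exp (2 * C))

theorem lowerConstant_pos (hL : 0 ≤ L) (hC : 0 < C) : 0 < lowerConstant L C := by
  rw [lowerConstant]
  positivity

theorem IsGreenSolution.le_sum_outerSites (hu : IsGreenSolution Λ V z u) (hN : 8 ≤ N) (hC : 0 < C)
    (hL : |V 1| + ‖z‖ ≤ L) (hw : TransferBoundedBy Λ V N (C * N ^ α) w)
    (hz : ‖z - w‖ ≤ 2 * N ^ (-(1 + α))) :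
    N / 8 * (lowerConstant L C * N ^ (-α)) ^ 2 ≤ ∑ n ∈ outerSites Λ N, ‖u n‖ ^ 2 := by
  have hL0 : 0 ≤ L := by linarith [abs_nonneg (V 1), norm_nonneg z]
  have hN0 : 0 < N := by linarith
  have hfloor : 0 ≤ ⌊N⌋ := Int.floor_nonneg.2 hN0.le
  have hsq : ∀ k, 0 ≤ ‖u k‖ ^ 2 := fun k => sq_nonneg _
  have sq_le {k : ℤ} (h : lowerConstant L C * N ^ (-α) ≤ ‖cauchyData u k‖) :
      (lowerConstant L C * N ^ (-α)) ^ 2 ≤ ‖u (k + 1)‖ ^ 2 + ‖u k‖ ^ 2 := by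
    have := lowerConstant_pos hL0 hC
    rw [← norm_sq_cauchyData]
    gcongr
  rcases hu.inv_le_norm_cauchyData_or hL with hκ | ⟨rfl, hκ⟩
  · have hsites : Icc 1 ⌊N⌋ ⊆ Λ.sites := fun k hk => by
      cases Λ
      exacts [mem_univ k, hk.1]
    refine mul_le_sum_outerSites_of_right hN (sq_nonneg _) hsq hsites fun k hk => sq_le ?_
    refine div_mul_rpow_le_norm_cauchyData hN0 hC (fun j hj => ?_) (fun j hj => ?_) ?_ hw hz
      (left_mem_Icc.2 (hk.1.trans hk.2)) hk hκ
    · exact hu.eq_of_ne_one (hsites ⟨hj.1.le, hj.2⟩) hj.1.ne'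
    · exact ⟨hsites hj, by linarith [hj.1], hj.2⟩
    · push_cast
      linarith [Int.floor_le N]
  · refine mul_le_sum_outerSites_of_left hN (sq_nonneg _) hsq (fun k _ => mem_univ k)
      fun k hk => sq_le ?_
    refine div_mul_rpow_le_norm_cauchyData hN0 hC (fun j hj => ?_) (fun j hj => ?_) ?_ hw hz
      (right_mem_Icc.2 (hk.1.trans hk.2)) hk hκ
    · exact hu.eq_of_ne_one (mem_univ j) (hj.2.trans_lt one_pos).ne
    · exact ⟨mem_univ j, hj.1, hj.2.trans hfloor⟩
    · push_cast
      linarith [Int.floor_le N]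

end LowerBound

section TimeAveragedLowerBound

variable {Λ : LatticeKind} {V : ℤ → ℝ} {K C α : ℝ}

theorem le_sum_norm_sq_greenFunction {N T E E' : ℝ} (hN : 8 ≤ N) (hT : N ^ (1 + α) = T)
    (hT1 : 1 ≤ T) (hC : 0 < C) (hE' : |E'| ≤ K)
    (hw : TransferBoundedBy Λ V N (C * N ^ α) E') (hE : |E - E'| ≤ 1 / T) :
    lowerConstant (|V 1| + K + 2) C ^ 2 / 8 * N ^ (1 - 2 * α)
      ≤ ∑ n ∈ outerSites Λ N, ‖greenFunction Λ V ((E : ℂ) + (1 / T : ℝ) * I) n‖ ^ 2 := by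
  set z : ℂ := (E : ℂ) + (1 / T : ℝ) * I with hz
  have hN0 : 0 < N := by linarith
  have hT0 : 0 < T := by linarith
  have hz_im : 0 < z.im := by simpa [hz] using hT0
  have norm_z_sub : ‖z - E'‖ ≤ 2 / T := by
    calc ‖z - E'‖ = ‖((E - E' : ℝ) : ℂ) + (1 / T : ℝ) * I‖ := by
          rw [hz]
          push_cast
          ring_nf
      _ ≤ |E - E'| + 1 / T := by
          refine (norm_add_le _ _).trans_eq ?_
          rw [norm_mul, norm_I, mul_one, norm_real, norm_real, Real.norm_eq_abs, Real.norm_eq_abs,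
            abs_of_pos (one_div_pos.2 hT0)]
      _ ≤ 1 / T + 1 / T := by gcongr
      _ = 2 / T := by ring
  have norm_z : ‖z‖ ≤ K + 2 := by
    have := norm_le_norm_add_norm_sub' z E'
    have : 2 / T ≤ 2 := div_le_self zero_le_two hT1
    rw [norm_real, Real.norm_eq_abs] at *
    linarith
  have h := (isGreenSolution_greenFunction hz_im).le_sum_outerSites hN hC
    (L := |V 1| + K + 2) (by linarith) hw (by rwa [Real.rpow_neg hN0.le, hT, ← div_eq_mul_inv])
  simp only [extendZero_apply] at h
  refine le_of_eq_of_le ?_ h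
  rw [mul_pow, ← Real.rpow_natCast (N ^ (-α)), ← Real.rpow_mul hN0.le, sub_eq_add_neg,
    Real.rpow_add hN0, Real.rpow_one]
  push_cast
  ring_nf

theorem scale_rpow {T : ℝ} (hα : 0 ≤ α) (hT : 0 ≤ T) : scale α T ^ (1 + α) = T := by
  rw [scale, ← Real.rpow_mul hT, one_div_mul_cancel (by positivity), Real.rpow_one]

theorem tendsto_scale (hα : 0 ≤ α) : Tendsto (scale α) atTop atTop :=
  tendsto_rpow_atTop (by positivity)

theorem eventually_le_sum_timeAverage (hC : 0 < C) (hα : 0 ≤ α) {A : ℝ → Set ℝ}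
    (hA : ∀ᶠ N in atTop, ∀ E ∈ A N, |E| ≤ K ∧ TransferBoundedBy Λ V N (C * N ^ α) E) :
    ∀ᶠ T : ℝ in atTop,
      ENNReal.ofReal (lowerConstant (|V 1| + K + 2) C ^ 2 / (16 * Real.pi) / T)
          * volume (energyNeighbourhood α A T) * ENNReal.ofReal (scale α T ^ (1 - 2 * α))
        ≤ ∑ n ∈ outerSites Λ (scale α T), ENNReal.ofReal (timeAverage Λ V n T) := by
  filter_upwards [(tendsto_scale hα).eventually hA, (tendsto_scale hα).eventually_ge_atTop 8,
    eventually_ge_atTop 1] with T hAT hN hT1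
  have hT0 : 0 < T := by linarith
  have hpos : 0 < 2 * Real.pi * T := by positivity
  set N := scale α T
  set c := lowerConstant (|V 1| + K + 2) C
  have h := ofReal_mul_volume_le_sum_timeAverage (Λ := Λ) (V := V) hT0 (outerSites Λ N)
    (B := energyNeighbourhood α A T) (c := c ^ 2 / 8 * N ^ (1 - 2 * α)) (by
      rintro E ⟨E', hE', hEE'⟩
      exact le_sum_norm_sq_greenFunction hN (scale_rpow hα hT0.le) hT1 hC (hAT E' hE').1
        (hAT E' hE').2 hEE')
  rw [← ENNReal.mul_le_mul_iff_right (ENNReal.ofReal_pos.2 hpos).ne' ENNReal.ofReal_ne_top]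
  refine le_of_eq_of_le ?_ h
  rw [mul_right_comm _ (volume _), ← mul_assoc, ← ENNReal.ofReal_mul (by positivity),
    ← ENNReal.ofReal_mul (by positivity)]
  congr 2
  field_simp
  ring

theorem sum_timeAverage_le_outsideProbability (Λ : LatticeKind) (V : ℤ → ℝ) (N T : ℝ) :
    ∑ n ∈ outerSites Λ N, ENNReal.ofReal (timeAverage Λ V n T)
      ≤ outsideProbability Λ V (N / 2) T := by
  refine le_of_le_of_eq ?_ (tsum_subtype {n : Λ.sites | N / 2 ≤ |((n : ℤ) : ℝ)|}
    fun n => ENNReal.ofReal (timeAverage Λ V n T)).symm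
  refine le_trans (le_of_eq (Finset.sum_congr rfl fun n hn => ?_)) (ENNReal.sum_le_tsum _)
  rw [indicator_of_mem]
  exact (mem_outerSites.1 hn).1

theorem half_rpow_abs_mul_rpow_le {x N : ℝ} (p : ℝ) (hN : 0 < N) (hx : N / 2 ≤ x) (hxN : x ≤ N) :
    (1 / 2 : ℝ) ^ |p| * N ^ p ≤ x ^ p := by
  have hx0 : 0 < x := by linarith
  have half_le : 1 / 2 ≤ x / N := by
    rw [le_div_iff₀ hN]
    linarith
  calc (1 / 2 : ℝ) ^ |p| * N ^ p ≤ (x / N) ^ |p| * N ^ p := by gcongr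
    _ ≤ (x / N) ^ p * N ^ p := by
        gcongr ?_ * _
        exact Real.rpow_le_rpow_of_exponent_ge (by positivity) ((div_le_one hN).2 hxN)
          (le_abs_self p)
    _ = x ^ p := by rw [Real.div_rpow hx0.le hN.le, div_mul_cancel₀ _ (by positivity)]

theorem mul_sum_timeAverage_le_moment (Λ : LatticeKind) (V : ℤ → ℝ) (p : ℝ) {N : ℝ}
    (hN : 0 < N) (T : ℝ) :
    ENNReal.ofReal ((1 / 2) ^ |p| * N ^ p)
        * ∑ n ∈ outerSites Λ N, ENNReal.ofReal (timeAverage Λ V n T)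
      ≤ moment Λ V p T := by
  rw [Finset.mul_sum]
  refine (Finset.sum_le_sum fun n hn => ?_).trans (ENNReal.sum_le_tsum (outerSites Λ N))
  rw [ENNReal.ofReal_mul (q := timeAverage Λ V n T) (by positivity)]
  gcongr
  exact half_rpow_abs_mul_rpow_le p hN (mem_outerSites.1 hn).1 (mem_outerSites.1 hn).2

theorem eventually_le_moment (hC : 0 < C) (hα : 0 ≤ α) (p : ℝ) {A : ℝ → Set ℝ}
    (hA : ∀ᶠ N in atTop, ∀ E ∈ A N, |E| ≤ K ∧ TransferBoundedBy Λ V N (C * N ^ α) E) :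
    ∀ᶠ T : ℝ in atTop,
      ENNReal.ofReal
            ((1 / 2) ^ |p| * (lowerConstant (|V 1| + K + 2) C ^ 2 / (16 * Real.pi)) / T)
          * volume (energyNeighbourhood α A T) * ENNReal.ofReal (scale α T ^ (p + 1 - 2 * α))
        ≤ moment Λ V p T := by
  filter_upwards [eventually_le_sum_timeAverage hC hα hA,
    (tendsto_scale hα).eventually_gt_atTop 0, eventually_gt_atTop 0] with T hsum hN hT
  set c := lowerConstant (|V 1| + K + 2) C ^ 2 / (16 * Real.pi)
  set N := scale α T
  have constant_eq : ENNReal.ofReal ((1 / 2) ^ |p| * c / T) * ENNReal.ofReal (N ^ (p + 1 - 2 * α))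
      = ENNReal.ofReal ((1 / 2) ^ |p| * N ^ p)
        * (ENNReal.ofReal (c / T) * ENNReal.ofReal (N ^ (1 - 2 * α))) := by
    rw [← ENNReal.ofReal_mul (by positivity), ← ENNReal.ofReal_mul (by positivity),
      ← ENNReal.ofReal_mul (by positivity), add_sub_assoc, Real.rpow_add hN]
    congr 1
    ring
  calc _ = ENNReal.ofReal ((1 / 2) ^ |p| * N ^ p) * (ENNReal.ofReal (c / T)
          * volume (energyNeighbourhood α A T) * ENNReal.ofReal (N ^ (1 - 2 * α))) := by
        rw [mul_right_comm, constant_eq, mul_assoc, mul_right_comm (ENNReal.ofReal (c / T))]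
    _ ≤ _ := (mul_le_mul_right hsum _).trans (mul_sum_timeAverage_le_moment Λ V p hN T)

theorem PowerLawBound.eventually_transferBoundedBy {A : ℝ → Set ℝ}
    (hA : PowerLawBound Λ V K C α A) :
    ∀ᶠ N in atTop, ∀ E ∈ A N, |E| ≤ K ∧ TransferBoundedBy Λ V N (C * N ^ α) E :=
  hA.mono fun _ hN E hE => ⟨abs_le.2 (hN.2.2.1 hE), hN.2.2.2 E hE⟩

end TimeAveragedLowerBound

end DiscreteSchrodinger

theorem theorem1_general (Λ : LatticeKind) (V : ℤ → ℝ) (K C α : ℝ) (hK : 0 ≤ K) (hC : 0 < C)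
    (hα : 0 ≤ α) :
    (∃ c : ℝ, 0 < c ∧ ∀ A : ℝ → Set ℝ,
      (∀ᶠ N in atTop, ∀ E ∈ A N, |E| ≤ K ∧ TransferBoundedBy Λ V N (C * N ^ α) E) →
      ∀ᶠ T : ℝ in atTop,
        ENNReal.ofReal (c / T) * volume (energyNeighbourhood α A T) *
            ENNReal.ofReal (scale α T ^ (1 - 2 * α)) ≤
          outsideProbability Λ V (scale α T / 2) T) ∧
    ∀ p : ℝ, ∃ c : ℝ, 0 < c ∧ ∀ A : ℝ → Set ℝ,
      (∀ᶠ N in atTop, ∀ E ∈ A N, |E| ≤ K ∧ TransferBoundedBy Λ V N (C * N ^ α) E) →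
      ∀ᶠ T : ℝ in atTop,
        ENNReal.ofReal (c / T) * volume (energyNeighbourhood α A T) *
            ENNReal.ofReal (scale α T ^ (p + 1 - 2 * α)) ≤
          moment Λ V p T := by
  have hc : 0 < lowerConstant (|V 1| + K + 2) C := lowerConstant_pos (by positivity) hC
  refine ⟨⟨lowerConstant (|V 1| + K + 2) C ^ 2 / (16 * Real.pi), by positivity, fun A hA => ?_⟩,
    fun p => ⟨(1 / 2) ^ |p| * (lowerConstant (|V 1| + K + 2) C ^ 2 / (16 * Real.pi)),
      by positivity, fun A hA => eventually_le_moment hC hα p hA⟩⟩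
  filter_upwards [eventually_le_sum_timeAverage hC hα hA] with T hT
  exact hT.trans (sum_timeAverage_le_outsideProbability Λ V _ T)

theorem theorem1 (Λ : LatticeKind) (V : ℤ → ℝ) (K C α : ℝ) (hK : 0 < K) (hC : 0 < C) (hα : 0 < α) :
    (∃ c : ℝ, 0 < c ∧ ∀ A : ℝ → Set ℝ, PowerLawBound Λ V K C α A → ∀ᶠ T : ℝ in atTop,
      ENNReal.ofReal (c / T) * volume (energyNeighbourhood α A T) *
          ENNReal.ofReal (scale α T ^ (1 - 2 * α)) ≤
        outsideProbability Λ V (scale α T / 2) T) ∧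
    ∀ p : ℝ, 0 < p → ∃ c : ℝ, 0 < c ∧ ∀ A : ℝ → Set ℝ, PowerLawBound Λ V K C α A →
      ∀ᶠ T : ℝ in atTop,
        ENNReal.ofReal (c / T) * volume (energyNeighbourhood α A T) *
            ENNReal.ofReal (scale α T ^ (p + 1 - 2 * α)) ≤
          moment Λ V p T := by
  obtain ⟨outside, moments⟩ := theorem1_general Λ V K C α hK.le hC hα.le
  exact ⟨outside.imp fun _ h => h.imp_right fun h A hA => h A hA.eventually_transferBoundedBy,
    fun p _ => (moments p).imp fun _ h => h.imp_right fun h A hA =>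
      h A hA.eventually_transferBoundedBy⟩
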